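/- All spaces are complex. Let $A$ be a Banach algebra (not necessarily unital) and $X$ a Banach $A$-bimodule, i.e. a Banach space with commuting left and right actions of $A$ given by bounded bilinear maps. For $n\ge 0$ let $C^n(A,X)$ be the normed space of bounded $n$-linear maps $A\times\dots\times A\to X$ (with $C^0(A,X)=X$), and let $\delta^n:C^n(A,X)\to C^{n+1}(A,X)$ be $$(\delta^n f)(a_1,\dots,a_{n+1})=a_1\cdot f(a_2,\dots,a_{n+1})+\sum_{i=1}^n(-1)^i f(a_1,\dots,a_ia_{i+1},\dots,a_{n+1})+(-1)^{n+1}f(a_1,\dots,a_n)\cdot a_{n+1}.$$ Put $Z^n(A,X)=\ker\delta^n$, $N^n(A,X)=\operatorname{im}\delta^{n-1}$ (with $N^0(A,X)=0$) and $\mathcal H^n(A,X)=Z^n(A,X)/N^n(A,X)$, with the quotient topology (a seminormed space). For a closed subalgebra $B$ of $A$, let $C^n_B(A,X)$ $(n\ge 1)$ be the space of those $\rho\in C^n(A,X)$ such that $$\rho(ba_1,a_2,\dots,a_n)=b\cdot\rho(a_1,\dots,a_n),\qquad \rho(a_1,\dots,a_nb)=\rho(a_1,\dots,a_n)\cdot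 b,$$ $$\rho(a_1,\dots,a_ib,a_{i+1},\dots,a_n)=\rho(a_1,\dots,a_i,ba_{i+1},\dots,a_n)\quad(1\le i<n)$$ for all $b\in B$ and $a_1,\dots,a_n\in A$, and let $C^0_B(A,X)=\{x\in X: b\cdot x=x\cdot b\text{ for all }b\in B\}$. These spaces form a subcomplex; let $Z^n_B(A,X)=C^n_B(A,X)\cap\ker\delta^n$, $N^n_B(A,X)=\delta^{n-1}(C^{n-1}_B(A,X))$ (with $N^0_B(A,X)=0$), and $\mathcal H^n_B(A,X)=Z^n_B(A,X)/N^n_B(A,X)$, again with the quotient topology. A dual $A$-bimodule is the Banach dual $M=(M_*)^*$ of a Banach $A$-bimodule $M_*$, with $(a\cdot\varphi)(x)=\varphi(x\cdot a)$ and $(\varphi\cdot a)(x)=\varphi(a\cdot x)$. A Banach algebra $D$ is amenable if $\mathcal H^1(D,M)=\{0\}$ for all dual $D$-bimodules $M$. **Theorem 1.6.** Let $A$ be a Banach algebra, let $B$ be an amenable closed subalgebra of $A$ and let $M$ be a dual $A$-bimodule. Then, for every $n\ge 0$, the map $$\mathcal H^n_B(A,M)\to\mathcal H^n(A,M),\qquad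 \rho+N^n_B(A,M)\mapsto\rho+N^n(A,M)\quad(\rho\in Z^n_B(A,M)),$$ induced by the inclusion of the $B$-relative cochains into all cochains, is a topological isomorphism. -/

import Mathlib

universe u v

noncomputable section

namespace BanachCohomology

/-- A Banach `A`-bimodule structure on the normed space `X` : two commuting actions of `A` on `X`,
given by bounded bilinear maps `(a, x) ↦ a · x` (`left`) and `(a, x) ↦ x · a` (`right`).
No identity element is involved and nothing like `e · x = x` is required. Completeness of `X` is
a separate assumption. -/
structure BanachBimodule (A : Type*) [NonUnitalNormedRing A] [NormedSpace ℂ A]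
    (X : Type*) [NormedAddCommGroup X] [NormedSpace ℂ X] where
  /-- `left a x` is `a · x`. -/
  left : A →L[ℂ] X →L[ℂ] X
  /-- `right a x` is `x · a`. -/
  right : A →L[ℂ] X →L[ℂ] X
  left_mul : ∀ a b x, left (a * b) x = left a (left b x)
  right_mul : ∀ a b x, right (a * b) x = right b (right a x)
  left_right : ∀ a b x, left a (right b x) = right b (left a x)

/-- The space `C^n(A, X)` of bounded `n`-linear maps `A × ⋯ × A → X`, with its operator norm.
For `n = 0` this is `X`, a cochain `f` being identified with its only value `f ![]`. -/
abbrev Cochain (A : Type*) [NonUnitalNormedRing A] [NormedSpace ℂ A]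
    (X : Type*) [NormedAddCommGroup X] [NormedSpace ℂ X] (n : ℕ) : Type _ :=
  ContinuousMultilinearMap ℂ (fun _ : Fin n => A) X

/-- The restriction of the norm of `A` makes a subalgebra of `A` a normed space. -/
instance {A : Type*} [NonUnitalNormedRing A] [NormedSpace ℂ A] (B : NonUnitalSubalgebra ℂ A) :
    NormedSpace ℂ B where
  norm_smul_le c b := norm_smul_le c (b : A)

section Algebra

variable {A : Type*} [NonUnitalNormedRing A]

/-- Changing one argument `a i` before contracting changes one argument after contracting. -/
theorem contract_update {n : ℕ} (j : Fin n) (a : Fin (n + 1) → A) (i : Fin (n + 1)) (x : A) :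
    j.castSucc.contractNth (· * ·) (Function.update a i x) =
      Function.update (j.castSucc.contractNth (· * ·) a) (j.predAbove i)
        (j.castSucc.contractNth (· * ·) (Function.update a i x) (j.predAbove i)) := by
  ext l
  by_cases hl : l = j.predAbove i
  · subst hl; simp
  · rw [Function.update_of_ne hl]
    have h : ¬ (l : ℕ) = (j.predAbove i : Fin n) := fun h => hl (Fin.ext h)
    simp only [Fin.predAbove, Fin.lt_def, Fin.val_castSucc] at h
    have h1 : (l : ℕ) ≤ j → l.castSucc ≠ i := by
      intro h1 h2
      have := congrArg Fin.val h2
      simp only [Fin.val_castSucc] at this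
      split_ifs at h <;> simp at h <;> omega
    have h2 : (j : ℕ) ≤ l → l.succ ≠ i := by
      intro h1 h2
      have := congrArg Fin.val h2
      simp only [Fin.val_succ] at this
      split_ifs at h <;> simp at h <;> omega
    simp only [Fin.contractNth, Fin.val_castSucc]
    split_ifs with h3 h4
    · rw [Function.update_of_ne (h1 (by omega))]
    · rw [Function.update_of_ne (h1 (by omega)), Function.update_of_ne (h2 (by omega))]
    · rw [Function.update_of_ne (h2 (by omega))]

theorem contract_update_add {n : ℕ} (j : Fin n) (a : Fin (n + 1) → A) (i : Fin (n + 1)) (x y : A) :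
    j.castSucc.contractNth (· * ·) (Function.update a i (x + y)) (j.predAbove i) =
      j.castSucc.contractNth (· * ·) (Function.update a i x) (j.predAbove i) +
        j.castSucc.contractNth (· * ·) (Function.update a i y) (j.predAbove i) := by
  simp only [Fin.contractNth, Fin.predAbove, Fin.lt_def, Fin.val_castSucc, Function.update_apply,
    Fin.ext_iff]
  split_ifs <;> simp_all [add_mul, mul_add] <;> omega

theorem continuous_contract {n : ℕ} (j : Fin n) :
    Continuous fun a : Fin (n + 1) → A => j.castSucc.contractNth (· * ·) a := by
  refine continuous_pi fun l => ?_
  simp only [Fin.contractNth]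
  split_ifs <;> fun_prop

variable [NormedSpace ℂ A] [IsScalarTower ℂ A A] [SMulCommClass ℂ A A]

theorem contract_update_smul {n : ℕ} (j : Fin n) (a : Fin (n + 1) → A) (i : Fin (n + 1)) (c : ℂ)
    (x : A) :
    j.castSucc.contractNth (· * ·) (Function.update a i (c • x)) (j.predAbove i) =
      c • j.castSucc.contractNth (· * ·) (Function.update a i x) (j.predAbove i) := by
  simp only [Fin.contractNth, Fin.predAbove, Fin.lt_def, Fin.val_castSucc, Function.update_apply,
    Fin.ext_iff]
  split_ifs <;> simp_all [smul_mul_assoc, mul_smul_comm] <;> omega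

variable {X : Type*} [NormedAddCommGroup X] [NormedSpace ℂ X]

/-- For a position `j` (counted from `0`), the cochain
`(a₀, …, aₙ) ↦ f (a₀, …, aⱼ aⱼ₊₁, …, aₙ)`. -/
def contract {n : ℕ} (j : Fin n) (f : Cochain A X n) : Cochain A X (n + 1) where
  toFun a := f (j.castSucc.contractNth (· * ·) a)
  map_update_add' := by
    intro inst a i x y
    rw [Subsingleton.elim inst (instDecidableEqFin (n + 1))]
    rw [contract_update, contract_update_add, f.map_update_add, ← contract_update,
      ← contract_update]
  map_update_smul' := by
    intro inst a i c x
    rw [Subsingleton.elim inst (instDecidableEqFin (n + 1))]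
    rw [contract_update, contract_update_smul, f.map_update_smul, ← contract_update]
  cont := f.cont.comp (continuous_contract j)

@[simp]
theorem contract_apply {n : ℕ} (j : Fin n) (f : Cochain A X n) (a : Fin (n + 1) → A) :
    contract j f a = f (j.castSucc.contractNth (· * ·) a) := rfl

end Algebra

namespace BanachBimodule

variable {A : Type*} [NonUnitalNormedRing A] [NormedSpace ℂ A]
variable {X : Type*} [NormedAddCommGroup X] [NormedSpace ℂ X]

/-- The dual bimodule structure on the Banach dual `X* = StrongDual ℂ X` :
`(a · φ) x = φ (x · a)` and `(φ · a) x = φ (a · x)`. -/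
def dual (m : BanachBimodule A X) : BanachBimodule A (StrongDual ℂ X) where
  left := (ContinuousLinearMap.compL ℂ X X ℂ).flip.comp m.right
  right := (ContinuousLinearMap.compL ℂ X X ℂ).flip.comp m.left
  left_mul a b φ := by ext x; simp [m.right_mul]
  right_mul a b φ := by ext x; simp [m.left_mul]
  left_right a b φ := by ext x; simp [m.left_right]

theorem dual_left_apply (m : BanachBimodule A X) (a : A) (φ : StrongDual ℂ X) (x : X) :
    m.dual.left a φ x = φ (m.right a x) := rfl

theorem dual_right_apply (m : BanachBimodule A X) (a : A) (φ : StrongDual ℂ X) (x : X) :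
    m.dual.right a φ x = φ (m.left a x) := rfl

/-- The cochain `(a₀, …, aₙ) ↦ a₀ · f (a₁, …, aₙ)`. -/
def leftTerm (m : BanachBimodule A X) {n : ℕ} (f : Cochain A X n) : Cochain A X (n + 1) :=
  ContinuousLinearMap.uncurryLeft
    (((ContinuousLinearMap.compContinuousMultilinearMapL ℂ (fun _ : Fin n => A) X X).flip f).comp
      m.left)

/-- The cochain `(a₀, …, aₙ) ↦ f (a₀, …, aₙ₋₁) · aₙ`. -/
def rightTerm (m : BanachBimodule A X) {n : ℕ} (f : Cochain A X n) : Cochain A X (n + 1) :=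
  ContinuousMultilinearMap.uncurryRight (m.right.flip.compContinuousMultilinearMap f)

variable [IsScalarTower ℂ A A] [SMulCommClass ℂ A A]

/-- The coboundary operator `δⁿ : C^n(A, X) → C^{n+1}(A, X)`; see `delta_apply` for the
formula. -/
def delta (m : BanachBimodule A X) (n : ℕ) : Cochain A X n →ₗ[ℂ] Cochain A X (n + 1) where
  toFun f := m.leftTerm f + ∑ j : Fin n, (-1 : ℂ) ^ ((j : ℕ) + 1) • contract j f +
    (-1 : ℂ) ^ (n + 1) • m.rightTerm f
  map_add' f g := by
    ext a
    simp only [leftTerm, rightTerm, add_apply,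
      sum_apply, smul_apply]
    simp [Finset.sum_add_distrib]
    abel
  map_smul' c f := by
    ext a
    simp [leftTerm, rightTerm, Finset.smul_sum, smul_comm c]

/-- The formula for the coboundary. Here `Fin.tail a = (a₁, …, aₙ)`, `Fin.init a = (a₀, …, aₙ₋₁)`
and `Fin.contractNth j (· * ·) a = (a₀, …, aⱼ aⱼ₊₁, …, aₙ)`, with indices counted from `0`. -/
theorem delta_apply (m : BanachBimodule A X) (n : ℕ) (f : Cochain A X n) (a : Fin (n + 1) → A) :
    m.delta n f a = m.left (a 0) (f (Fin.tail a)) +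
      ∑ j : Fin n, (-1 : ℂ) ^ ((j : ℕ) + 1) • f (j.castSucc.contractNth (· * ·) a) +
      (-1 : ℂ) ^ (n + 1) • m.right (a (Fin.last n)) (f (Fin.init a)) := by
  simp [delta, leftTerm, rightTerm]

/-- The space `Z^n(A, X)` of `n`-cocycles. -/
def cocycles (m : BanachBimodule A X) (n : ℕ) : Submodule ℂ (Cochain A X n) :=
  LinearMap.ker (m.delta n)

/-- The space `N^n(A, X)` of `n`-coboundaries (zero for `n = 0`). -/
def coboundaries (m : BanachBimodule A X) : (n : ℕ) → Submodule ℂ (Cochain A X n)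
  | 0 => ⊥
  | n + 1 => LinearMap.range (m.delta n)

/-- The cohomology group `H^n(A, X) = Z^n(A, X) / N^n(A, X)`, with the quotient of the norm
topology (given by the quotient seminorm, not Hausdorff in general). -/
abbrev Cohomology (m : BanachBimodule A X) (n : ℕ) : Type _ :=
  m.cocycles n ⧸ (m.coboundaries n).submoduleOf (m.cocycles n)

/-- The space `C_S^n(A, X)` of `S`-relative `n`-cochains. For `n = 0` it is the space of the
`x : X` with `s · x = x · s` for all `s ∈ S`. For `n ≥ 1` it consists of the cochains `f` with
`f (s a₁, a₂, …) = s · f (a₁, a₂, …)`,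
`f (…, aᵢ s, aᵢ₊₁, …) = f (…, aᵢ, s aᵢ₊₁, …)` and
`f (…, aₙ₋₁, aₙ s) = f (…, aₙ₋₁, aₙ) · s`. -/
def relCochains (m : BanachBimodule A X) (S : NonUnitalSubalgebra ℂ A) :
    (n : ℕ) → Submodule ℂ (Cochain A X n)
  | 0 =>
    { carrier := {f | ∀ s ∈ S, m.left s (f ![]) = m.right s (f ![])}
      add_mem' := fun hf hg s hs => by simp [hf s hs, hg s hs]
      zero_mem' := fun s _ => by simp
      smul_mem' := fun c f hf s hs => by simp [hf s hs] }
  | n + 1 =>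
    { carrier := {f | ∀ s ∈ S, ∀ a : Fin (n + 1) → A,
        f (Function.update a 0 (s * a 0)) = m.left s (f a) ∧
        (∀ i : Fin n, f (Function.update a i.castSucc (a i.castSucc * s)) =
          f (Function.update a i.succ (s * a i.succ))) ∧
        f (Function.update a (Fin.last n) (a (Fin.last n) * s)) = m.right s (f a)}
      add_mem' := fun hf hg s hs a => by
        obtain ⟨h1, h2, h3⟩ := hf s hs a
        obtain ⟨h1', h2', h3'⟩ := hg s hs a
        exact ⟨by simp [h1, h1'], fun i => by simp [h2 i, h2' i], by simp [h3, h3']⟩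
      zero_mem' := fun s _ a => by simp
      smul_mem' := fun c f hf s hs a => by
        obtain ⟨h1, h2, h3⟩ := hf s hs a
        exact ⟨by simp [h1], fun i => by simp [h2 i], by simp [h3]⟩ }

/-- The space `Z_S^n(A, X)` of `S`-relative `n`-cocycles. -/
def relCocycles (m : BanachBimodule A X) (S : NonUnitalSubalgebra ℂ A) (n : ℕ) :
    Submodule ℂ (Cochain A X n) :=
  m.relCochains S n ⊓ LinearMap.ker (m.delta n)

/-- The space `N_S^n(A, X)` of `S`-relative `n`-coboundaries: the image under the coboundary of
the `S`-relative cochains (zero for `n = 0`). -/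
def relCoboundaries (m : BanachBimodule A X) (S : NonUnitalSubalgebra ℂ A) :
    (n : ℕ) → Submodule ℂ (Cochain A X n)
  | 0 => ⊥
  | n + 1 => (m.relCochains S n).map (m.delta n)

/-- The `S`-relative cohomology group `H_S^n(A, X) = Z_S^n(A, X) / N_S^n(A, X)`, with the quotient
of the norm topology. -/
abbrev RelCohomology (m : BanachBimodule A X) (S : NonUnitalSubalgebra ℂ A) (n : ℕ) : Type _ :=
  m.relCocycles S n ⧸ (m.relCoboundaries S n).submoduleOf (m.relCocycles S n)

theorem relCocycles_le (m : BanachBimodule A X) (S : NonUnitalSubalgebra ℂ A) (n : ℕ) :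
    m.relCocycles S n ≤ m.cocycles n := inf_le_right

theorem relCoboundaries_le (m : BanachBimodule A X) (S : NonUnitalSubalgebra ℂ A) (n : ℕ) :
    m.relCoboundaries S n ≤ m.coboundaries n := by
  cases n with
  | zero => exact le_rfl
  | succ n => exact LinearMap.map_le_range

/-- The map `H_S^n(A, X) → H^n(A, X)`, `ρ + N_S^n(A, X) ↦ ρ + N^n(A, X)`, induced by the inclusion
of the `S`-relative cochains into all cochains. -/
def relToCohomology (m : BanachBimodule A X) (S : NonUnitalSubalgebra ℂ A) (n : ℕ) :
    m.RelCohomology S n →ₗ[ℂ] m.Cohomology n :=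
  Submodule.mapQ _ _ (Submodule.inclusion (m.relCocycles_le S n))
    (fun _ hx => m.relCoboundaries_le S n hx)

end BanachBimodule

/-- A Banach algebra `A` is amenable if `H^1(A, Y*) = 0` for every Banach `A`-bimodule `Y`, where
`Y*` is the dual bimodule. -/
def IsAmenable (A : Type u) [NonUnitalNormedRing A] [NormedSpace ℂ A]
    [IsScalarTower ℂ A A] [SMulCommClass ℂ A A] : Prop :=
  ∀ (Y : Type v) [NormedAddCommGroup Y] [NormedSpace ℂ Y] [CompleteSpace Y]
    (m : BanachBimodule A Y), Subsingleton (m.dual.Cohomology 1)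

end BanachCohomology

end

set_option linter.unusedSectionVars false

/-! Write B⁺ for the unitization of `B`. Bounded derivations of `B` into dual bimodules are inner;
for b ↦ (Φ ↦ Φ(1, b)), with Φ ranging over bounded bilinear forms on B⁺ × B, this gives a functional
N with N(Φ · b) - N(b · Φ) = Φ(1, b) (`IsAmenable.exists_functional`), a substitute for a virtual
diagonal.

Applying N to (c, d) ↦ f(…, aₖ₋₁c, d, aₖ, …) lowers the degree of a cochain f by one. If f vanishes
when one of its first k arguments lies in `B`, and δf when any of its arguments does, then the
coboundary of this average is (-1)^k f where argument k (counted from 0) lies in `B`, and is 0 where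
an earlier one does (`ev_eq_ev_delta_average`, `ev_delta_average_eq_zero`). Subtracting coboundaries
slot by slot makes f vanish once any argument is in `B` (`exists_vanishesBelow`). Inserting b ∈ `B`
into δf then leaves two terms, whose equality is a `B`-relation for f
(`isRelative_of_vanishesBelow`). This gives surjectivity.

For injectivity, let δξ be relative. The same reduction gives η with δ(ξ - η) vanishing on `B`, so ξ
- η is relative up to a coboundary. It remains to have η relative, that is, averaging must preserve
the `B`-relations. This holds once N, restricted to forms θ(cd), is a two-sided identity of the
bidual (`IsAmenable.exists_normalized_functional`).

The inverse is continuous by the open mapping theorem for (ρ, g) ↦ ρ + δg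
(`isOpenMap_mapQ_inclusion`). -/

noncomputable section

namespace BanachCohomology

/-! ### Inner derivations of an amenable algebra -/

section AmenableAlgebra

variable {D : Type u} [NonUnitalNormedRing D] [NormedSpace ℂ D]

/-- The transport of a bimodule structure along `ULift`. -/
def BanachBimodule.ulift {X : Type*} [NormedAddCommGroup X] [NormedSpace ℂ X]
    (m : BanachBimodule D X) : BanachBimodule D (ULift.{v} X) where
  left := LinearMap.mkContinuous₂ (LinearMap.mk₂ ℂ (fun a x => ULift.up (m.left a x.down))
    (fun _ _ _ => by ext; simp) (fun _ _ _ => by ext; simp)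
    (fun _ _ _ => by ext; simp) (fun _ _ _ => by ext; simp)) ‖m.left‖
    (fun a x => m.left.le_opNorm₂ a x.down)
  right := LinearMap.mkContinuous₂ (LinearMap.mk₂ ℂ (fun a x => ULift.up (m.right a x.down))
    (fun _ _ _ => by ext; simp) (fun _ _ _ => by ext; simp)
    (fun _ _ _ => by ext; simp) (fun _ _ _ => by ext; simp)) ‖m.right‖
    (fun a x => m.right.le_opNorm₂ a x.down)
  left_mul a b x := congrArg ULift.up (m.left_mul a b x.down)
  right_mul a b x := congrArg ULift.up (m.right_mul a b x.down)
  left_right a b x := congrArg ULift.up (m.left_right a b x.down)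

section Inner

variable [IsScalarTower ℂ D D] [SMulCommClass ℂ D D]

/-- Bounded derivations of an amenable Banach algebra into a dual bimodule are inner. -/
theorem IsAmenable.exists_eq_inner (hD : IsAmenable.{u, v} D) {X : Type v}
    [NormedAddCommGroup X] [NormedSpace ℂ X] [CompleteSpace X] (m : BanachBimodule D X)
    (d : D →L[ℂ] StrongDual ℂ X)
    (hd : ∀ a b x, d (a * b) x = d b (m.right a x) + d a (m.left b x)) :
    ∃ N : StrongDual ℂ X, ∀ b x, d b x = N (m.right b x) - N (m.left b x) := by
  have hs := hD X m
  let f : Cochain D (StrongDual ℂ X) 1 :=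
    (ContinuousMultilinearMap.ofSubsingleton ℂ D (StrongDual ℂ X) (0 : Fin 1)) d
  have hf : f ∈ m.dual.cocycles 1 := by
    rw [BanachBimodule.cocycles, LinearMap.mem_ker]
    ext a x
    rw [BanachBimodule.delta_apply]
    simp [f, BanachBimodule.dual_left_apply, BanachBimodule.dual_right_apply, Fin.tail, Fin.init,
      Fin.contractNth, hd]
  have h0 : (⟨f, hf⟩ : m.dual.cocycles 1) ∈ (m.dual.coboundaries 1).submoduleOf _ := by
    rw [← Submodule.Quotient.mk_eq_zero]
    exact Subsingleton.elim _ _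
  obtain ⟨N, hN⟩ : f ∈ LinearMap.range (m.dual.delta 0) := h0
  refine ⟨N ![], fun b x => ?_⟩
  have h1 := congrArg (fun g => g ![b] x) hN
  simp only [BanachBimodule.delta_apply] at h1
  have e1 : ∀ g : Fin 0 → D, N g = N ![] := fun g => congrArg N (Subsingleton.elim _ _)
  simp [f, BanachBimodule.dual_left_apply, BanachBimodule.dual_right_apply, e1] at h1
  rw [← h1, sub_eq_add_neg]

/-- Amenability tests bimodules in the universe `max u v` only, while the forms on `D` live in `u`;
the derivation is moved along `ULift` and the functional pulled back. -/
theorem IsAmenable.exists_eq_inner_lift (hD : IsAmenable.{u, max u v} D) {X : Type u}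
    [NormedAddCommGroup X] [NormedSpace ℂ X] [CompleteSpace X] (m : BanachBimodule D X)
    (d : D →L[ℂ] StrongDual ℂ X)
    (hd : ∀ a b x, d (a * b) x = d b (m.right a x) + d a (m.left b x)) :
    ∃ N : StrongDual ℂ X, ∀ b x, d b x = N (m.right b x) - N (m.left b x) := by
  let up : X →L[ℂ] ULift.{v} X := (ContinuousLinearEquiv.ulift (R₁ := ℂ) (M₁ := X)).symm
  let down : ULift.{v} X →L[ℂ] X := (ContinuousLinearEquiv.ulift (R₁ := ℂ) (M₁ := X))
  have : CompleteSpace (ULift.{v} X) :=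
    (completeSpace_congr (e := Equiv.ulift) (isometry_iff_dist_eq.2 fun _ _ => rfl
      ).isUniformEmbedding).2 ‹_›
  let pre : StrongDual ℂ X →L[ℂ] StrongDual ℂ (ULift.{v} X) :=
    (ContinuousLinearMap.compL ℂ (ULift.{v} X) X ℂ).flip down
  obtain ⟨N, hN⟩ := hD.exists_eq_inner (BanachBimodule.ulift.{u, v} m)
    (pre.comp d) (fun a b x => hd a b x.down)
  exact ⟨N.comp up, fun b x => hN b (ULift.up x)⟩

end Inner

/-! ### Bilinear forms on D⁺ × D -/

variable (D) in
/-- Bounded bilinear forms on `D⁺ × D`, where `D⁺` is the unitization of `D`: the pair `(φ, ψ)`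
stands for the form `(c + t, d) ↦ φ c d + t * ψ d`. -/
def UnitizedForm : Type u := (D →L[ℂ] D →L[ℂ] ℂ) × (D →L[ℂ] ℂ)

namespace UnitizedForm

instance : NormedAddCommGroup (UnitizedForm D) :=
  inferInstanceAs (NormedAddCommGroup ((D →L[ℂ] D →L[ℂ] ℂ) × (D →L[ℂ] ℂ)))

instance : NormedSpace ℂ (UnitizedForm D) :=
  inferInstanceAs (NormedSpace ℂ ((D →L[ℂ] D →L[ℂ] ℂ) × (D →L[ℂ] ℂ)))

instance : CompleteSpace (UnitizedForm D) :=
  inferInstanceAs (CompleteSpace ((D →L[ℂ] D →L[ℂ] ℂ) × (D →L[ℂ] ℂ)))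

/-- The restriction of a form to `D × D`. -/
def onProd : UnitizedForm D →L[ℂ] D →L[ℂ] D →L[ℂ] ℂ :=
  ContinuousLinearMap.fst ℂ (D →L[ℂ] D →L[ℂ] ℂ) (D →L[ℂ] ℂ)

/-- The restriction of a form to `1 × D`. -/
def onOne : UnitizedForm D →L[ℂ] D →L[ℂ] ℂ :=
  ContinuousLinearMap.snd ℂ (D →L[ℂ] D →L[ℂ] ℂ) (D →L[ℂ] ℂ)

/-- The form with given restrictions to `D × D` and `1 × D`. -/
def mk (φ : D →L[ℂ] D →L[ℂ] ℂ) (ψ : D →L[ℂ] ℂ) : UnitizedForm D := (φ, ψ)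

@[simp]
theorem onProd_mk (φ : D →L[ℂ] D →L[ℂ] ℂ) (ψ : D →L[ℂ] ℂ) : onProd (mk φ ψ) = φ := rfl

@[simp]
theorem onOne_mk (φ : D →L[ℂ] D →L[ℂ] ℂ) (ψ : D →L[ℂ] ℂ) : onOne (mk φ ψ) = ψ := rfl

theorem ext {Φ Ψ : UnitizedForm D} (h₁ : ∀ c d, onProd Φ c d = onProd Ψ c d)
    (h₂ : ∀ d, onOne Φ d = onOne Ψ d) : Φ = Ψ :=
  Prod.ext (ContinuousLinearMap.ext fun c => ContinuousLinearMap.ext fun d => h₁ c d)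
    (ContinuousLinearMap.ext h₂)

theorem norm_onProd_apply_le (Φ : UnitizedForm D) (c d : D) :
    ‖onProd Φ c d‖ ≤ ‖Φ‖ * ‖c‖ * ‖d‖ :=
  ((onProd Φ).le_opNorm₂ c d).trans (by gcongr; exact le_max_left ‖Φ.1‖ ‖Φ.2‖)

theorem norm_onOne_apply_le (Φ : UnitizedForm D) (d : D) : ‖onOne Φ d‖ ≤ ‖Φ‖ * ‖d‖ :=
  ((onOne Φ).le_opNorm d).trans (by gcongr; exact le_max_right ‖Φ.1‖ ‖Φ.2‖)

theorem norm_le {Φ : UnitizedForm D} {C : ℝ} (hC : 0 ≤ C)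
    (h₁ : ∀ c d, ‖onProd Φ c d‖ ≤ C * ‖c‖ * ‖d‖) (h₂ : ∀ d, ‖onOne Φ d‖ ≤ C * ‖d‖) : ‖Φ‖ ≤ C :=
  max_le (ContinuousLinearMap.opNorm_le_bound₂ _ hC h₁) (ContinuousLinearMap.opNorm_le_bound _ hC h₂)

set_option synthInstance.maxHeartbeats 200000 in
/-- The form supported on `1 × D` given by a functional. -/
def inr : (D →L[ℂ] ℂ) →L[ℂ] UnitizedForm D :=
  LinearMap.mkContinuous
    { toFun := fun ψ => mk 0 ψ
      map_add' := fun _ _ => UnitizedForm.ext (fun _ _ => by simp) (fun _ => by simp)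
      map_smul' := fun _ _ => UnitizedForm.ext (fun _ _ => by simp) (fun _ => by simp) } 1
    (fun ψ => norm_le (by positivity) (fun c d => by simp; positivity)
      (fun d => by simpa using ψ.le_opNorm d))

@[simp]
theorem onProd_inr (ψ : D →L[ℂ] ℂ) : onProd (inr ψ) = 0 := rfl

@[simp]
theorem onOne_inr (ψ : D →L[ℂ] ℂ) : onOne (inr ψ) = ψ := rfl

variable [IsScalarTower ℂ D D] [SMulCommClass ℂ D D]

/-- The bilinear form `(c, d) ↦ θ (c d)`. -/
def pull : (D →L[ℂ] ℂ) →L[ℂ] (D →L[ℂ] D →L[ℂ] ℂ) :=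
  ((ContinuousLinearMap.compL ℂ D (D →L[ℂ] D) (D →L[ℂ] ℂ)).flip (ContinuousLinearMap.mul ℂ D)).comp
    (ContinuousLinearMap.compL ℂ D D ℂ)

@[simp]
theorem pull_apply (θ : D →L[ℂ] ℂ) (c d : D) : pull θ c d = θ (c * d) := rfl

/-- The form `(c, d) ↦ θ (c d)` on `D⁺ × D`. -/
def ofMul : (D →L[ℂ] ℂ) →L[ℂ] UnitizedForm D :=
  LinearMap.mkContinuous
    { toFun := fun θ => mk (pull θ) θ
      map_add' := fun _ _ => UnitizedForm.ext (fun _ _ => by simp) (fun _ => by simp)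
      map_smul' := fun _ _ => UnitizedForm.ext (fun _ _ => by simp) (fun _ => by simp) } 1
    (fun θ => norm_le (by positivity)
      (fun c d => by
        simpa [mul_assoc] using (θ.le_opNorm (c * d)).trans
          (mul_le_mul_of_nonneg_left (norm_mul_le c d) (norm_nonneg θ)))
      (fun d => by simpa using θ.le_opNorm d))

@[simp]
theorem onProd_ofMul (θ : D →L[ℂ] ℂ) (c d : D) : onProd (ofMul θ) c d = θ (c * d) := rfl

@[simp]
theorem onOne_ofMul (θ : D →L[ℂ] ℂ) : onOne (ofMul θ) = θ := rfl

/-- The form `(c, d) ↦ Φ (c, d b) - Φ (c d, b)`. -/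
def leftAct (b : D) (Φ : UnitizedForm D) : UnitizedForm D :=
  mk (((ContinuousLinearMap.compL ℂ D D ℂ).flip ((ContinuousLinearMap.mul ℂ D).flip b)).comp (onProd Φ) -
    (ContinuousLinearMap.compL ℂ D D ℂ ((onProd Φ).flip b)).comp (ContinuousLinearMap.mul ℂ D))
   ((onOne Φ).comp ((ContinuousLinearMap.mul ℂ D).flip b) - (onProd Φ).flip b)

/-- The form `(c, d) ↦ Φ (b c, d)`. -/
def rightAct (b : D) (Φ : UnitizedForm D) : UnitizedForm D :=
  mk ((onProd Φ).comp (ContinuousLinearMap.mul ℂ D b)) (onProd Φ b)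

@[simp]
theorem leftAct_onProd (b c d : D) (Φ : UnitizedForm D) :
    onProd (Φ.leftAct b) c d = onProd Φ c (d * b) - onProd Φ (c * d) b := by
  simp [leftAct]

@[simp]
theorem leftAct_onOne (b d : D) (Φ : UnitizedForm D) :
    onOne (Φ.leftAct b) d = onOne Φ (d * b) - onProd Φ d b := by
  simp [leftAct]

@[simp]
theorem rightAct_onProd (b c d : D) (Φ : UnitizedForm D) :
    onProd (Φ.rightAct b) c d = onProd Φ (b * c) d := by
  simp [rightAct]

@[simp]
theorem rightAct_onOne (b d : D) (Φ : UnitizedForm D) :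
    onOne (Φ.rightAct b) d = onProd Φ b d := by
  simp [rightAct]

theorem norm_leftAct_le (b : D) (Φ : UnitizedForm D) :
    ‖Φ.leftAct b‖ ≤ 2 * ‖b‖ * ‖Φ‖ := by
  refine norm_le (by positivity) (fun c d => ?_) (fun d => ?_)
  · rw [leftAct_onProd]
    have h₁ := (Φ.norm_onProd_apply_le c (d * b)).trans
      (mul_le_mul_of_nonneg_left (norm_mul_le d b) (by positivity))
    have h₂ := (Φ.norm_onProd_apply_le (c * d) b).trans (mul_le_mul_of_nonneg_right
      (mul_le_mul_of_nonneg_left (norm_mul_le c d) (norm_nonneg Φ)) (norm_nonneg b))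
    linarith [norm_sub_le (onProd Φ c (d * b)) (onProd Φ (c * d) b)]
  · rw [leftAct_onOne]
    have h₁ := (Φ.norm_onOne_apply_le (d * b)).trans
      (mul_le_mul_of_nonneg_left (norm_mul_le d b) (by positivity))
    have h₂ := Φ.norm_onProd_apply_le d b
    linarith [norm_sub_le (onOne Φ (d * b)) (onProd Φ d b)]

theorem norm_rightAct_le (b : D) (Φ : UnitizedForm D) :
    ‖Φ.rightAct b‖ ≤ 1 * ‖b‖ * ‖Φ‖ := by
  refine norm_le (by positivity) (fun c d => ?_) (fun d => ?_)
  · rw [rightAct_onProd]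
    have h₁ := (Φ.norm_onProd_apply_le (b * c) d).trans (mul_le_mul_of_nonneg_right
      (mul_le_mul_of_nonneg_left (norm_mul_le b c) (norm_nonneg Φ)) (norm_nonneg d))
    linarith
  · rw [rightAct_onOne]
    linarith [Φ.norm_onProd_apply_le b d]

/-- The correction term makes this telescope: in a · (b · Φ) the two occurrences of Φ(cda, b)
cancel. -/
theorem leftAct_mul (a b : D) (Φ : UnitizedForm D) :
    Φ.leftAct (a * b) = (Φ.leftAct b).leftAct a :=
  UnitizedForm.ext (fun _ _ => by simp [mul_assoc]) (fun _ => by simp [mul_assoc])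

theorem rightAct_mul (a b : D) (Φ : UnitizedForm D) :
    Φ.rightAct (a * b) = (Φ.rightAct a).rightAct b :=
  UnitizedForm.ext (fun _ _ => by simp [mul_assoc]) (fun _ => by simp)

theorem leftAct_rightAct (a b : D) (Φ : UnitizedForm D) :
    (Φ.rightAct b).leftAct a = (Φ.leftAct a).rightAct b :=
  UnitizedForm.ext (fun _ _ => by simp [mul_assoc]) (fun _ => by simp)

end UnitizedForm

/-! ### The averaging functional and its normalization -/

variable [IsScalarTower ℂ D D] [SMulCommClass ℂ D D]

open UnitizedForm

/-- The bimodule of bounded bilinear forms on `D⁺ × D` with actions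
`(Φ · b)(c, d) = Φ (b c, d)` and `(b · Φ)(c, d) = Φ (c, d b) - Φ (c d, b)`. -/
def unitizedFormBimodule : BanachBimodule D (UnitizedForm D) where
  left := LinearMap.mkContinuous₂ (LinearMap.mk₂ ℂ leftAct
    (fun _ _ _ => UnitizedForm.ext (fun _ _ => by simp [mul_add]; ring)
      (fun _ => by simp [mul_add]; ring))
    (fun _ _ _ => UnitizedForm.ext (fun _ _ => by simp [mul_smul_comm, mul_sub])
      (fun _ => by simp [mul_smul_comm, mul_sub]))
    (fun _ _ _ => UnitizedForm.ext (fun _ _ => by simp; ring) (fun _ => by simp; ring))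
    (fun _ _ _ => UnitizedForm.ext (fun _ _ => by simp [mul_sub]) (fun _ => by simp [mul_sub])))
    2 norm_leftAct_le
  right := LinearMap.mkContinuous₂ (LinearMap.mk₂ ℂ rightAct
    (fun _ _ _ => UnitizedForm.ext (fun _ _ => by simp [add_mul]) (fun _ => by simp))
    (fun _ _ _ => UnitizedForm.ext (fun _ _ => by simp [smul_mul_assoc]) (fun _ => by simp))
    (fun _ _ _ => UnitizedForm.ext (fun _ _ => by simp) (fun _ => by simp))
    (fun _ _ _ => UnitizedForm.ext (fun _ _ => by simp) (fun _ => by simp)))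
    1 norm_rightAct_le
  left_mul a b Φ := leftAct_mul a b Φ
  right_mul a b Φ := rightAct_mul a b Φ
  left_right a b Φ := leftAct_rightAct a b Φ

theorem unitizedFormBimodule_left (b : D) (Φ : UnitizedForm D) :
    unitizedFormBimodule.left b Φ = Φ.leftAct b := rfl

theorem unitizedFormBimodule_right (b : D) (Φ : UnitizedForm D) :
    unitizedFormBimodule.right b Φ = Φ.rightAct b := rfl

/-- A functional which makes the universal derivation of an amenable algebra inner. -/
theorem IsAmenable.exists_functional (hD : IsAmenable.{u, max u v} D) :
    ∃ N : StrongDual ℂ (UnitizedForm D), ∀ b Φ,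
      N (Φ.rightAct b) - N (Φ.leftAct b) = onOne Φ b := by
  -- Leibniz rule: (Φ · a)(1, b) = Φ(a, b) and (b · Φ)(1, a) = Φ(1, ab) - Φ(a, b) add up to Φ(1,
  -- ab).
  let d : D →L[ℂ] StrongDual ℂ (UnitizedForm D) := onOne.flip
  obtain ⟨N, hN⟩ := hD.exists_eq_inner_lift unitizedFormBimodule
    d (fun a b Φ => by simp [d, unitizedFormBimodule_left, unitizedFormBimodule_right])
  exact ⟨N, fun b Φ => (hN b Φ).symm⟩

/-- The functional of `IsAmenable.exists_functional` can be chosen so that its restriction to the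
forms `θ (c d)` is a two-sided identity of the bidual. -/
theorem IsAmenable.exists_normalized_functional (hD : IsAmenable.{u, max u v} D) :
    ∃ N : StrongDual ℂ (UnitizedForm D),
      (∀ b Φ, N (Φ.rightAct b) - N (Φ.leftAct b) = onOne Φ b) ∧
      (∀ (θ : D →L[ℂ] ℂ) b, N (ofMul (θ.comp (ContinuousLinearMap.mul ℂ D b))) = θ b) ∧
      (∀ (θ : D →L[ℂ] ℂ) b, N (ofMul (θ.comp ((ContinuousLinearMap.mul ℂ D).flip b))) = θ b) := by
  obtain ⟨N, hN⟩ := hD.exists_functional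
  let mul := ContinuousLinearMap.mul ℂ D
  -- Forms supported on 1 × D are killed by the right action, so N yields a one-sided identity of
  -- the bidual from them.
  let G : (D →L[ℂ] ℂ) →L[ℂ] ℂ := -N.comp inr
  have hG : ∀ (θ : D →L[ℂ] ℂ) b, G (θ.comp (mul.flip b)) = θ b := fun θ b => by
    have h := hN b (inr θ)
    have h1 : rightAct b (inr θ) = 0 :=
      UnitizedForm.ext (fun _ _ => by simp) (fun _ => by simp)
    have h2 : leftAct b (inr θ) = inr (θ.comp (mul.flip b)) :=
      UnitizedForm.ext (by simp) (by simp [mul])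
    rw [h1, h2] at h
    simpa [G] using h
  -- Forms θ(cd) are killed by the left action, which yields an identity on the other side.
  let F : (D →L[ℂ] ℂ) →L[ℂ] ℂ := N.comp ofMul
  have hF : ∀ (θ : D →L[ℂ] ℂ) b, F (θ.comp (mul b)) = θ b := fun θ b => by
    have h := hN b (ofMul θ)
    have h1 : (ofMul θ).rightAct b =
        ofMul (θ.comp (mul b)) :=
      UnitizedForm.ext (by simp [mul, mul_assoc]) (by simp [mul])
    have h2 : (ofMul θ).leftAct b = 0 :=
      UnitizedForm.ext (by simp [mul_assoc]) (by simp)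
    rw [h1, h2] at h
    simpa [F] using h
  -- The usual combination F + G - FG of two one-sided identities, with an Arens product FG; it
  -- works on both sides.
  let e : (D →L[ℂ] ℂ) →L[ℂ] ℂ := F + G - F.comp ((ContinuousLinearMap.compL ℂ _ _ _ G).comp pull)
  have heL : ∀ (θ : D →L[ℂ] ℂ) b, e (θ.comp (mul b)) = θ b := fun θ b => by
    have h1 : (G.comp (pull (θ.comp (mul b)))) = (G.comp (pull θ)).comp (mul b) := by
      ext c
      simp only [ContinuousLinearMap.comp_apply]
      congr 1
      ext d
      simp [mul, mul_assoc]
    have h2 : pull θ b = θ.comp (mul b) := by ext d; simp [mul]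
    have h3 : F (G.comp (pull (θ.comp (mul b)))) = G (θ.comp (mul b)) := by
      rw [h1, hF, ContinuousLinearMap.comp_apply, h2]
    simp only [e, sub_apply, add_apply,
      ContinuousLinearMap.comp_apply, ContinuousLinearMap.compL_apply, h3, hF]
    ring
  have heR : ∀ (θ : D →L[ℂ] ℂ) b, e (θ.comp (mul.flip b)) = θ b := fun θ b => by
    have h1 : (G.comp (pull (θ.comp (mul.flip b)))) = θ.comp (mul.flip b) := by
      ext c
      have h2 : pull (θ.comp (mul.flip b)) c = (θ.comp (mul c)).comp (mul.flip b) := by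
        ext d; simp [mul, mul_assoc]
      rw [ContinuousLinearMap.comp_apply, h2, hG]
      simp [mul]
    simp only [e, sub_apply, add_apply,
      ContinuousLinearMap.comp_apply, ContinuousLinearMap.compL_apply, h1, hG]
    ring
  let L : UnitizedForm D →L[ℂ] D →L[ℂ] UnitizedForm D := unitizedFormBimodule.left.flip
  -- The first term averages N(x · Φ) over x with e. It kills every form θ(cd) and violates the
  -- required identity by e(Φ(b, ·)). The second term repairs both: it takes the value e(θ) on
  -- θ(cd), and Φ · b contributes e(Φ(b, ·)).
  let N' : StrongDual ℂ (UnitizedForm D) :=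
    e.comp ((ContinuousLinearMap.compL ℂ _ _ _ N).comp L) +
      e.comp ((ContinuousLinearMap.compL ℂ _ _ _ e).comp onProd)
  have hN' : ∀ Φ, N' Φ = e (N.comp (L Φ)) + e (e.comp (onProd Φ)) := fun Φ => rfl
  have hmul : ∀ θ, N' (ofMul θ) = e θ := fun θ => by
    have h1 : L (ofMul θ) = 0 := by
      ext1 b
      exact UnitizedForm.ext (by simp [L, unitizedFormBimodule_left, mul_assoc])
        (by simp [L, unitizedFormBimodule_left])
    have h2 : e.comp (onProd (ofMul θ)) = θ := by
      ext c
      have h3 : onProd (ofMul θ) c = θ.comp (mul c) := by ext d; simp [mul]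
      rw [ContinuousLinearMap.comp_apply, h3, heL]
    rw [hN', h1, h2]
    simp
  refine ⟨N', fun b Φ => ?_, fun θ b => ?_, fun θ b => ?_⟩
  · have h1 : N.comp (L (Φ.rightAct b)) =
        (N.comp (L Φ)).comp (mul b) + (onOne Φ).comp (mul b) - onProd Φ b := by
      ext x
      have h := hN b (Φ.leftAct x)
      rw [← leftAct_rightAct, ← leftAct_mul, leftAct_onOne] at h
      simp only [ContinuousLinearMap.comp_apply, sub_apply,
        add_apply, L, ContinuousLinearMap.flip_apply, mul,
        ContinuousLinearMap.mul_apply', unitizedFormBimodule_left]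
      linear_combination h
    have h2 : e.comp (onProd (Φ.rightAct b)) = (e.comp (onProd Φ)).comp (mul b) := by
      ext c
      simp only [ContinuousLinearMap.comp_apply]
      congr 1
    have h3 : N.comp (L (Φ.leftAct b)) = (N.comp (L Φ)).comp (mul.flip b) := by
      ext x
      rw [← unitizedFormBimodule_left]
      simp only [ContinuousLinearMap.comp_apply, L, ContinuousLinearMap.flip_apply, mul,
        ContinuousLinearMap.mul_apply', unitizedFormBimodule.left_mul]
    have h4 : e.comp (onProd (Φ.leftAct b)) = 0 := by
      ext c
      have h5 : onProd (Φ.leftAct b) c =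
          (onProd Φ c).comp (mul.flip b) - ((onProd Φ).flip b).comp (mul c) := by
        ext d
        simp [mul]
      rw [ContinuousLinearMap.comp_apply, h5, map_sub, heR, heL]
      simp
    rw [hN', hN', h1, h2, h3, h4, map_sub, map_add, heL, heL, heL, heR]
    simp
  · rw [hmul]; exact heL θ b
  · rw [hmul]; exact heR θ b

end AmenableAlgebra

/-! ### Cochains as functions on words -/

/-- An argument of the multilinear forms `(y, a₀, …, aₙ₋₁) ↦ f (a₀, …, aₙ₋₁) y` for all `n` at
the same time: a point `y` followed by a sequence in `A`. -/
abbrev Word (A Y : Type*) := Y × (ℕ → A)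

section Words

variable {A : Type*} [NonUnitalNormedRing A] [NormedSpace ℂ A]
  {Y : Type*} [NormedAddCommGroup Y] [NormedSpace ℂ Y]

/-- The value of a cochain on a word. -/
def Cochain.ev {n : ℕ} (f : Cochain A (StrongDual ℂ Y) n) (w : Word A Y) : ℂ :=
  f (fun i => w.2 i) w.1

theorem Cochain.ev_congr {n : ℕ} (f : Cochain A (StrongDual ℂ Y) n) {w w' : Word A Y}
    (h₁ : w.1 = w'.1) (h₂ : ∀ l < n, w.2 l = w'.2 l) : Cochain.ev f w = Cochain.ev f w' := by
  have : (fun i : Fin n => w.2 i) = fun i : Fin n => w'.2 i := funext fun i => h₂ i i.2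
  rw [Cochain.ev, Cochain.ev, this, h₁]

theorem Cochain.ext_ev {n : ℕ} {f g : Cochain A (StrongDual ℂ Y) n}
    (h : ∀ w, Cochain.ev f w = Cochain.ev g w) : f = g := by
  ext a y
  -- A finite tuple is padded with zeros; the entries beyond the degree are never read.
  have := h (y, fun l => if hl : l < n then a ⟨l, hl⟩ else 0)
  simpa [Cochain.ev] using this

@[simp]
theorem Cochain.ev_add {n : ℕ} (f g : Cochain A (StrongDual ℂ Y) n) (w : Word A Y) :
    Cochain.ev (f + g) w = Cochain.ev f w + Cochain.ev g w := rfl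

@[simp]
theorem Cochain.ev_sub {n : ℕ} (f g : Cochain A (StrongDual ℂ Y) n) (w : Word A Y) :
    Cochain.ev (f - g) w = Cochain.ev f w - Cochain.ev g w := rfl

@[simp]
theorem Cochain.ev_smul {n : ℕ} (c : ℂ) (f : Cochain A (StrongDual ℂ Y) n) (w : Word A Y) :
    Cochain.ev (c • f) w = c * Cochain.ev f w := rfl

@[simp]
theorem Cochain.ev_zero {n : ℕ} (w : Word A Y) :
    Cochain.ev (0 : Cochain A (StrongDual ℂ Y) n) w = 0 := rfl

namespace Word

/-- Removes the entry at position `k`. -/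
def del (k : ℕ) (w : Word A Y) : Word A Y := (w.1, fun l => if l < k then w.2 l else w.2 (l + 1))

/-- Inserts the entry `d` at position `k`. -/
def ins (k : ℕ) (d : A) (w : Word A Y) : Word A Y :=
  (w.1, fun l => if l < k then w.2 l else if l = k then d else w.2 (l - 1))

/-- Multiplies the entry in front of position `k` by `x` from the right; for `k = 0` this is the
point of `Y`. -/
def rmul (m : BanachBimodule A Y) : ℕ → A → Word A Y → Word A Y
  | 0, x, w => (m.right x w.1, w.2)
  | k + 1, x, w => (w.1, fun l => if l = k then w.2 l * x else w.2 l)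

/-- Multiplies the entry at position `k` by `x` from the left, where the words of length `n` are
closed up to cycles. -/
def lmul (m : BanachBimodule A Y) (n k : ℕ) (x : A) (w : Word A Y) : Word A Y :=
  if k < n then (w.1, fun l => if l = k then x * w.2 l else w.2 l) else (m.left x w.1, w.2)

/-- Merges the entry at position `k` into the one in front of it. -/
def merge (m : BanachBimodule A Y) (k : ℕ) (w : Word A Y) : Word A Y := del k (rmul m k (w.2 k) w)

/-- The faces of a word of length `n + 1`. -/
def face (m : BanachBimodule A Y) (n k : ℕ) (w : Word A Y) : Word A Y :=
  if k ≤ n then merge m k w else (m.left (w.2 n) w.1, w.2)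

variable (m : BanachBimodule A Y)

@[simp] theorem del_fst (k : ℕ) (w : Word A Y) : (del k w).1 = w.1 := rfl

theorem del_snd (k : ℕ) (w : Word A Y) (l : ℕ) :
    (del k w).2 l = if l < k then w.2 l else w.2 (l + 1) := rfl

@[simp] theorem ins_fst (k : ℕ) (d : A) (w : Word A Y) : (ins k d w).1 = w.1 := rfl

theorem ins_snd (k : ℕ) (d : A) (w : Word A Y) (l : ℕ) :
    (ins k d w).2 l = if l < k then w.2 l else if l = k then d else w.2 (l - 1) := rfl

theorem rmul_fst (k : ℕ) (x : A) (w : Word A Y) :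
    (rmul m k x w).1 = if k = 0 then m.right x w.1 else w.1 := by
  cases k <;> simp [rmul]

theorem rmul_snd (k : ℕ) (x : A) (w : Word A Y) (l : ℕ) :
    (rmul m k x w).2 l = if l + 1 = k then w.2 l * x else w.2 l := by
  cases k <;> simp [rmul]

theorem lmul_fst (n k : ℕ) (x : A) (w : Word A Y) :
    (lmul m n k x w).1 = if k < n then w.1 else m.left x w.1 := by
  unfold lmul; split_ifs <;> rfl

theorem lmul_snd (n k : ℕ) (x : A) (w : Word A Y) (l : ℕ) :
    (lmul m n k x w).2 l = if k < n ∧ l = k then x * w.2 l else w.2 l := by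
  unfold lmul; split_ifs <;> simp_all

theorem merge_fst (k : ℕ) (w : Word A Y) :
    (merge m k w).1 = if k = 0 then m.right (w.2 k) w.1 else w.1 := by
  simp [merge, rmul_fst]

theorem merge_snd (k : ℕ) (w : Word A Y) (l : ℕ) :
    (merge m k w).2 l = if l + 1 < k then w.2 l else if l + 1 = k then w.2 l * w.2 k
      else w.2 (l + 1) := by
  simp only [merge, del_snd, rmul_snd]
  split_ifs <;> first | rfl | omega

theorem face_fst (n k : ℕ) (w : Word A Y) :
    (face m n k w).1 = if k ≤ n then (if k = 0 then m.right (w.2 k) w.1 else w.1)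
      else m.left (w.2 n) w.1 := by
  unfold face; split_ifs with h h' <;> simp_all [merge_fst]

theorem face_snd (n k : ℕ) (w : Word A Y) (l : ℕ) :
    (face m n k w).2 l = if k ≤ n then (if l + 1 < k then w.2 l else
      if l + 1 = k then w.2 l * w.2 k else w.2 (l + 1)) else w.2 l := by
  unfold face; split_ifs <;> simp_all [merge_snd]

end Word

open Word

variable [IsScalarTower ℂ A A] [SMulCommClass ℂ A A] (m : BanachBimodule A Y)

/-- Since (a · φ)(y) = φ(y · a) and (φ · a)(y) = φ(a · y), the outer terms of δ are also merges of
neighbours once y is placed between the last and the first argument. All terms become faces of a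
cyclic word. -/
theorem Cochain.ev_delta {n : ℕ} (f : Cochain A (StrongDual ℂ Y) n) (w : Word A Y) :
    Cochain.ev (m.dual.delta n f) w =
      ∑ i ∈ Finset.range (n + 2), (-1) ^ i * Cochain.ev f (face m n i w) := by
  rw [Finset.sum_range_succ, Finset.sum_range_succ', Cochain.ev, BanachBimodule.delta_apply]
  simp only [add_apply, smul_apply, sum_apply,
    BanachBimodule.dual_left_apply, BanachBimodule.dual_right_apply, smul_eq_mul, pow_zero, one_mul]
  rw [add_comm (m.right _ _ |> f _) _, Finset.sum_range]
  congr 2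
  · refine Finset.sum_congr rfl fun j _ => ?_
    congr 1
    refine Eq.trans ?_ (Cochain.ev_congr f (w := (w.1, (merge m (j + 1) w).2)) ?_ fun l hl => ?_)
    · rw [Cochain.ev]
      congr 2
      ext l
      simp only [Fin.contractNth, merge_snd]
      simp
      split_ifs <;> first | rfl | omega | simp_all
    · simp [face_fst]
    · simp [face_snd, merge_snd]
  · refine Eq.trans ?_ (Cochain.ev_congr f (w := (m.left (w.2 n) w.1, w.2)) ?_ fun l hl => ?_)
    · rfl
    · simp [face_fst]
    · simp [face_snd]

end Words

/-! ### Simplicial identities -/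

open Word

/-- The pairs (j, i + 1) with j ≤ i match the pairs (i, j) with opposite signs; splitting the square
along the diagonal separates the two halves. -/
theorem sum_sum_simplicial_eq_zero (N : ℕ) (G : ℕ → ℕ → ℂ)
    (hG : ∀ i < N, ∀ j ≤ i, G j (i + 1) = G i j) :
    ∑ i ∈ Finset.range (N + 1), ∑ j ∈ Finset.range N, (-1) ^ (i + j) * G j i = 0 := by
  have h : ∀ i j, (-1) ^ (i + j) * G j i =
      (if j < i then (-1) ^ (i + j) * G j i else 0) +
        (if j < i then 0 else (-1) ^ (i + j) * G j i) := fun i j => by split_ifs <;> simp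
  rw [Finset.sum_congr rfl fun i _ => (Finset.sum_congr rfl fun j _ => h i j).trans
    Finset.sum_add_distrib, Finset.sum_add_distrib,
    Finset.sum_range_succ' (n := N), Finset.sum_range_succ (n := N), add_add_add_comm,
    Finset.sum_comm (f := fun i j => if j < i then (0 : ℂ) else (-1) ^ (i + j) * G j i),
    ← Finset.sum_add_distrib]
  have h0 : ∑ j ∈ Finset.range N, (if j < N then (0 : ℂ) else (-1) ^ (N + j) * G j N) = 0 :=
    Finset.sum_eq_zero fun j hj => if_pos (Finset.mem_range.1 hj)
  rw [h0]
  simp only [Nat.not_lt_zero, if_false, Finset.sum_const_zero, add_zero]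
  refine Finset.sum_eq_zero fun i hi => ?_
  rw [← Finset.sum_add_distrib]
  refine Finset.sum_eq_zero fun j _ => ?_
  by_cases hji : j ≤ i
  · rw [if_pos (by omega), if_neg (by omega), hG i (Finset.mem_range.1 hi) j hji]
    ring
  · rw [if_neg (by omega), if_pos (by omega), add_zero]

section Homotopy

variable {A : Type*} [NonUnitalNormedRing A] [NormedSpace ℂ A]
  {Y : Type*} [NormedAddCommGroup Y] [NormedSpace ℂ Y] (m : BanachBimodule A Y)

namespace Word

theorem merge_ins (k : ℕ) (d : A) (w : Word A Y) : merge m k (ins k d w) = rmul m k d w := by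
  refine Prod.ext ?_ (funext fun l => ?_)
  · simp [merge_fst, rmul_fst, ins_snd]
  · simp only [merge_snd, rmul_snd, ins_snd]
    grind

theorem ins_del (k : ℕ) (w : Word A Y) : ins k (w.2 k) (del k w) = w := by
  refine Prod.ext rfl (funext fun l => ?_)
  simp only [ins_snd, del_snd]
  grind

theorem rmul_rmul (k : ℕ) (x y : A) (w : Word A Y) :
    rmul m k y (rmul m k x w) = rmul m k (x * y) w := by
  refine Prod.ext ?_ (funext fun l => ?_)
  · simp only [rmul_fst, m.right_mul]
    split_ifs <;> rfl
  · simp only [rmul_snd]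
    split_ifs <;> simp [mul_assoc]

theorem rmul_del (k : ℕ) (x : A) (w : Word A Y) : rmul m k x (del k w) = del k (rmul m k x w) := by
  refine Prod.ext ?_ (funext fun l => ?_)
  · simp [rmul_fst]
  · simp only [rmul_snd, del_snd]
    grind

theorem face_of_le {n k : ℕ} (hk : k ≤ n) (w : Word A Y) : face m n k w = merge m k w := if_pos hk

theorem rmul_ins (k : ℕ) (c d : A) (w : Word A Y) :
    rmul m k c (ins k d w) = ins k d (rmul m k c w) := by
  refine Prod.ext ?_ (funext fun l => ?_)
  · simp [rmul_fst]
  · simp only [rmul_snd, ins_snd]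
    grind

theorem face_ins_rmul (k n : ℕ) (hk : k ≤ n) (c d : A) (w : Word A Y) :
    face m n k (ins k d (rmul m k c w)) = rmul m k (c * d) w := by
  rw [face_of_le m hk, merge_ins, rmul_rmul]

theorem face_succ_ins_rmul (k n : ℕ) (hk : k + 1 ≤ n) (c d : A) (w : Word A Y) :
    face m n (k + 1) (ins k d (rmul m k c w)) = ins k (d * w.2 k) (rmul m k c (del k w)) := by
  rw [face_of_le m hk]
  refine Prod.ext ?_ (funext fun l => ?_)
  · simp [merge_fst, rmul_fst]
  · simp only [merge_snd, rmul_snd, ins_snd, del_snd]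
    grind

theorem face_ins_rmul_of_gt (k n i : ℕ) (hk : k < i) (hn : k ≤ n) (c d : A) (w : Word A Y) :
    face m (n + 1) (i + 1) (ins k d (rmul m k c w)) = ins k d (rmul m k c (face m n i w)) := by
  refine Prod.ext ?_ (funext fun l => ?_)
  · simp only [face_fst, rmul_fst, ins_snd, rmul_snd, ins_fst]
    grind [m.left_right]
  · simp only [face_snd, rmul_snd, ins_snd]
    grind

/-- A face at or before the slot `k` removes an entry before the inserted pair, so the slot is `k +
1` in the original word. -/
theorem ins_rmul_face_of_le (k n i : ℕ) (hk : i ≤ k) (hn : k ≤ n) (c d : A) (w : Word A Y) :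
    ins k d (rmul m k c (face m n i w)) = face m (n + 1) i (ins (k + 1) d (rmul m (k + 1) c w)) := by
  refine Prod.ext ?_ (funext fun l => ?_)
  · simp only [face_fst, rmul_fst, ins_snd, rmul_snd, ins_fst]
    grind [m.right_mul]
  · simp only [face_snd, rmul_snd, ins_snd]
    grind

/-- Equality is claimed only for the first `n` entries: a last face leaves its used entry in the
tail, while the other faces shift the tail. -/
theorem face_face (n i j : ℕ) (hj : j ≤ i) (hi : i ≤ n + 1) (w : Word A Y) :
    (face m n j (face m (n + 1) (i + 1) w)).1 = (face m n i (face m (n + 1) j w)).1 ∧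
    ∀ l < n, (face m n j (face m (n + 1) (i + 1) w)).2 l =
      (face m n i (face m (n + 1) j w)).2 l := by
  refine ⟨?_, fun l hl => ?_⟩
  · simp only [face_fst, face_snd]
    grind [m.right_mul, m.left_mul, m.left_right]
  · simp only [face_snd]
    grind

end Word

end Homotopy

/-! ### Averages of cochains over an inserted pair -/

section Averaging

variable {A : Type u} [NonUnitalNormedRing A] [NormedSpace ℂ A] [IsScalarTower ℂ A A]
  [SMulCommClass ℂ A A] {Y : Type v} [NormedAddCommGroup Y] [NormedSpace ℂ Y]
  (m : BanachBimodule A Y)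

theorem BanachBimodule.dual_delta_delta {n : ℕ} (f : Cochain A (StrongDual ℂ Y) n) :
    m.dual.delta (n + 1) (m.dual.delta n f) = 0 := by
  refine Cochain.ext_ev fun w => ?_
  rw [Cochain.ev_delta, Cochain.ev_zero, ← sum_sum_simplicial_eq_zero (n + 2)
    (fun j i => Cochain.ev f (face m n j (face m (n + 1) i w)))]
  · refine Finset.sum_congr rfl fun i _ => ?_
    rw [Cochain.ev_delta, Finset.mul_sum]
    exact Finset.sum_congr rfl fun j _ => by ring
  · intro i hi j hj
    obtain ⟨h₁, h₂⟩ := face_face m n i j hj (by omega) w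
    exact Cochain.ev_congr f h₁ h₂

/-- The cochain `(y, a₀, …, aₙ) ↦ f (…, aₖ₋₁ aₖ, …)`, where `aₖ` acts on `y` for `k = 0`. -/
def mergeLeft {n : ℕ} (k : Fin (n + 1)) (f : Cochain A (StrongDual ℂ Y) n) :
    Cochain A (StrongDual ℂ Y) (n + 1) :=
  Fin.cases (m.dual.leftTerm f) (fun j => contract j f) k

theorem ev_mergeLeft {n : ℕ} (k : Fin (n + 1)) (f : Cochain A (StrongDual ℂ Y) n) (w : Word A Y) :
    Cochain.ev (mergeLeft m k f) w = Cochain.ev f (merge m k w) := by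
  induction k using Fin.cases with
  | zero =>
    refine Eq.trans ?_ (Cochain.ev_congr f (w := (m.right (w.2 0) w.1, fun l => w.2 (l + 1))) ?_
      fun l hl => ?_)
    · simp [mergeLeft, Cochain.ev, BanachBimodule.leftTerm, BanachBimodule.dual_left_apply]
      rfl
    · simp [merge_fst]
    · simp [merge_snd]
  | succ j =>
    refine Eq.trans ?_ (Cochain.ev_congr f (w := (w.1, (merge m (j + 1) w).2)) ?_ fun l hl => ?_)
    · simp only [mergeLeft, Fin.cases_succ, Cochain.ev, contract_apply]
      congr 2
      ext l
      simp only [Fin.contractNth, merge_snd]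
      simp
      split_ifs <;> first | rfl | omega | simp_all
    · simp [merge_fst]
    · simp [merge_snd]

theorem ev_curryMid {n : ℕ} (k : Fin (n + 1)) (f : Cochain A (StrongDual ℂ Y) (n + 1)) (d : A)
    (w : Word A Y) :
    Cochain.ev (f.curryMid k d : Cochain A (StrongDual ℂ Y) n) w = Cochain.ev f (ins k d w) := by
  have h : (fun i : Fin (n + 1) => (ins k d w).2 i) = k.insertNth d fun i : Fin n => w.2 i := by
    ext i
    refine Fin.succAboveCases k ?_ (fun j => ?_) i
    · simp [ins_snd]
    · rw [Fin.insertNth_apply_succAbove]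
      rcases lt_or_ge j.castSucc k with h | h
      · rw [Fin.succAbove_of_castSucc_lt _ _ h]
        exact if_pos h
      · rw [Fin.succAbove_of_le_castSucc _ _ h]
        have h' : (k : ℕ) ≤ j := h
        simp only [ins_snd, Fin.val_succ]
        rw [if_neg (by omega), if_neg (by omega), Nat.add_sub_cancel]
  rw [Cochain.ev, Cochain.ev, h]
  rfl

/-- The bilinear map `(c, d) ↦ f (…, aₖ₋₁ c, d, aₖ, …)`. -/
def insertPair {n : ℕ} (k : Fin (n + 1)) (f : Cochain A (StrongDual ℂ Y) (n + 1)) :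
    A →L[ℂ] A →L[ℂ] Cochain A (StrongDual ℂ Y) n :=
  -- Currying `mergeLeft` twice at the same slot places c directly in front of d; the merge then
  -- absorbs c into the entry before it.
  ((ContinuousMultilinearMap.curryMidEquiv ℂ (fun _ : Fin (n + 1) => A) (StrongDual ℂ Y)
    k).toContinuousLinearEquiv : Cochain A (StrongDual ℂ Y) (n + 1) →L[ℂ]
      A →L[ℂ] Cochain A (StrongDual ℂ Y) n).comp
    ((mergeLeft m k.castSucc f).curryMid k.castSucc)

theorem ev_insertPair {n : ℕ} (k : Fin (n + 1)) (f : Cochain A (StrongDual ℂ Y) (n + 1)) (c d : A)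
    (w : Word A Y) :
    Cochain.ev (insertPair m k f c d) w = Cochain.ev f (ins k d (rmul m k c w)) := by
  have h : Cochain.ev (insertPair m k f c d) w =
      Cochain.ev (((mergeLeft m k.castSucc f).curryMid k.castSucc c).curryMid k d :
        Cochain A (StrongDual ℂ Y) n) w := rfl
  rw [h, ev_curryMid]
  have h' := ev_curryMid k.castSucc (mergeLeft m k.castSucc f) c (ins k d w)
  refine h'.trans ?_
  rw [ev_mergeLeft, Fin.val_castSucc, merge_ins, rmul_ins]

variable {B : NonUnitalSubalgebra ℂ A}

variable (B) in
/-- The inclusion of a subalgebra as a bounded linear map. -/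
def inclusionL : B →L[ℂ] A :=
  LinearMap.mkContinuous
    { toFun := fun b => (b : A)
      map_add' := fun _ _ => rfl
      map_smul' := fun _ _ => rfl } 1 (fun b => (one_mul ‖(b : A)‖).ge)

/-- The composition of a pair of a bilinear and a linear map with a functional. -/
def UnitizedForm.ofFunctional {D : Type*} [NonUnitalNormedRing D] [NormedSpace ℂ D]
    {Z : Type*} [NormedAddCommGroup Z] [NormedSpace ℂ Z] (T : D →L[ℂ] D →L[ℂ] Z) (S : D →L[ℂ] Z) :
    (Z →L[ℂ] ℂ) →L[ℂ] UnitizedForm D :=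
  LinearMap.mkContinuous
    { toFun := fun ℓ => UnitizedForm.mk ((ContinuousLinearMap.compL ℂ D Z ℂ ℓ).comp T) (ℓ.comp S)
      map_add' := fun _ _ => UnitizedForm.ext (fun _ _ => by simp) (fun _ => by simp)
      map_smul' := fun _ _ => UnitizedForm.ext (fun _ _ => by simp) (fun _ => by simp) }
    (‖T‖ + ‖S‖) (fun ℓ => by
      refine UnitizedForm.norm_le (by positivity) (fun c d => ?_) (fun d => ?_)
      · calc ‖ℓ (T c d)‖ ≤ ‖ℓ‖ * (‖T‖ * ‖c‖ * ‖d‖) :=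
              (ℓ.le_opNorm _).trans (by gcongr; exact T.le_opNorm₂ c d)
          _ ≤ ‖ℓ‖ * ((‖T‖ + ‖S‖) * ‖c‖ * ‖d‖) := by gcongr; simp
          _ = (‖T‖ + ‖S‖) * ‖ℓ‖ * ‖c‖ * ‖d‖ := by ring
      · calc ‖ℓ (S d)‖ ≤ ‖ℓ‖ * (‖S‖ * ‖d‖) :=
              (ℓ.le_opNorm _).trans (by gcongr; exact S.le_opNorm d)
          _ ≤ ‖ℓ‖ * ((‖T‖ + ‖S‖) * ‖d‖) := by gcongr; simp [norm_nonneg T]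
          _ = (‖T‖ + ‖S‖) * ‖ℓ‖ * ‖d‖ := by ring)

/-- The evaluation of cochains at a word, as a functional. -/
def evFunctional (n : ℕ) (w : Word A Y) : Cochain A (StrongDual ℂ Y) n →L[ℂ] ℂ :=
  (ContinuousLinearMap.apply ℂ ℂ w.1).comp
    (ContinuousMultilinearMap.apply ℂ (fun _ : Fin n => A) (StrongDual ℂ Y) (fun i => w.2 i))

variable (B) in
/-- The form `(c, d) ↦ f (…, aₖ₋₁ c, d, aₖ, …)` on `B⁺ × B`. -/
def insertForm {n : ℕ} (k : Fin (n + 1)) (f : Cochain A (StrongDual ℂ Y) (n + 1)) :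
    (Cochain A (StrongDual ℂ Y) n →L[ℂ] ℂ) →L[ℂ] UnitizedForm B :=
  UnitizedForm.ofFunctional
    (((ContinuousLinearMap.compL ℂ B A (Cochain A (StrongDual ℂ Y) n)).flip (inclusionL B)).comp
      ((insertPair m k f).comp (inclusionL B)))
    ((f.curryMid k : A →L[ℂ] Cochain A (StrongDual ℂ Y) n).comp (inclusionL B))

@[simp]
theorem onProd_insertForm {n : ℕ} (k : Fin (n + 1)) (f : Cochain A (StrongDual ℂ Y) (n + 1))
    (w : Word A Y) (c d : B) :
    UnitizedForm.onProd (insertForm m B k f (evFunctional n w)) c d =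
      Cochain.ev f (ins k (d : A) (rmul m k (c : A) w)) :=
  ev_insertPair m k f c d w

@[simp]
theorem onOne_insertForm {n : ℕ} (k : Fin (n + 1)) (f : Cochain A (StrongDual ℂ Y) (n + 1))
    (w : Word A Y) (d : B) :
    UnitizedForm.onOne (insertForm m B k f (evFunctional n w)) d =
      Cochain.ev f (ins k (d : A) w) :=
  ev_curryMid k f d w

/-- The average of `f (…, aₖ₋₁ c, d, aₖ, …)` with respect to a functional on the forms on
`B⁺ × B`. -/
def average (N : StrongDual ℂ (UnitizedForm B)) {n : ℕ} (k : Fin (n + 1))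
    (f : Cochain A (StrongDual ℂ Y) (n + 1)) : Cochain A (StrongDual ℂ Y) n :=
  -- A tuple is sent to its evaluation map on cochains, flipped to a map from Y to functionals on
  -- cochains, and composed with N. Multilinearity and boundedness are thus inherited from the
  -- universal evaluation.
  ((ContinuousLinearMap.compL ℂ Y (Cochain A (StrongDual ℂ Y) n →L[ℂ] ℂ) ℂ
      (N.comp (insertForm m B k f))).comp
    ((ContinuousLinearMap.flipₗᵢ ℂ (Cochain A (StrongDual ℂ Y) n) Y ℂ).toContinuousLinearEquiv :
      (Cochain A (StrongDual ℂ Y) n →L[ℂ] Y →L[ℂ] ℂ) →L[ℂ]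
        Y →L[ℂ] Cochain A (StrongDual ℂ Y) n →L[ℂ] ℂ)).compContinuousMultilinearMap
    (ContinuousLinearMap.id ℂ (Cochain A (StrongDual ℂ Y) n)).flipMultilinear

theorem ev_average (N : StrongDual ℂ (UnitizedForm B)) {n : ℕ} (k : Fin (n + 1))
    (f : Cochain A (StrongDual ℂ Y) (n + 1)) (w : Word A Y) :
    Cochain.ev (average m N k f) w = N (insertForm m B k f (evFunctional n w)) :=
  rfl

end Averaging

/-! ### Making a cochain vanish on one more slot -/

section Step

variable {A : Type u} [NonUnitalNormedRing A] [NormedSpace ℂ A] [IsScalarTower ℂ A A]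
  [SMulCommClass ℂ A A] {Y : Type v} [NormedAddCommGroup Y] [NormedSpace ℂ Y]
  (m : BanachBimodule A Y) {B : NonUnitalSubalgebra ℂ A}

namespace Word

theorem face_ins (k n : ℕ) (hk : k ≤ n) (d : A) (w : Word A Y) :
    face m n k (ins k d w) = rmul m k d w := by
  rw [face_of_le m hk, merge_ins]

theorem face_succ_ins (k n : ℕ) (hk : k + 1 ≤ n) (d : A) (w : Word A Y) :
    face m n (k + 1) (ins k d w) = ins k (d * w.2 k) (del k w) := by
  rw [face_of_le m hk]
  refine Prod.ext ?_ (funext fun l => ?_)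
  · simp [merge_fst]
  · simp only [merge_snd, ins_snd, del_snd]
    grind

theorem face_ins_of_gt (k n i : ℕ) (hk : k < i) (hn : k ≤ n) (d : A) (w : Word A Y) :
    face m (n + 1) (i + 1) (ins k d w) = ins k d (face m n i w) := by
  refine Prod.ext ?_ (funext fun l => ?_)
  · simp only [face_fst, ins_snd, ins_fst]
    grind
  · simp only [face_snd, ins_snd]
    grind

theorem ins_face_of_le (k n i : ℕ) (hk : i ≤ k) (hn : k ≤ n) (d : A) (w : Word A Y) :
    ins k d (face m n i w) = face m (n + 1) i (ins (k + 1) d w) := by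
  refine Prod.ext ?_ (funext fun l => ?_)
  · simp only [face_fst, ins_snd, ins_fst]
    grind
  · simp only [face_snd, ins_snd]
    grind

end Word

variable (B) in
/-- The cochain vanishes if one of its first `k` arguments lies in `B`. -/
def VanishesBelow (k : ℕ) {n : ℕ} (f : Cochain A (StrongDual ℂ Y) n) : Prop :=
  ∀ j < k, ∀ w : Word A Y, w.2 j ∈ B → Cochain.ev f w = 0

/-- A face before `k` moves the entry in `B` to position `k - 1`, where f vanishes. -/
theorem ev_delta_eq_sum_Ico {n k : ℕ} (hk : k ≤ n) {f : Cochain A (StrongDual ℂ Y) n}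
    (hf : VanishesBelow B k f) {w : Word A Y} (hw : w.2 k ∈ B) :
    Cochain.ev (m.dual.delta n f) w =
      ∑ i ∈ Finset.Ico k (n + 2), (-1) ^ i * Cochain.ev f (face m n i w) := by
  rw [Cochain.ev_delta, Finset.range_eq_Ico,
    ← Finset.sum_Ico_consecutive _ (Nat.zero_le k) (by omega : k ≤ n + 2), add_eq_right]
  refine Finset.sum_eq_zero fun i hi => ?_
  have hi' := (Finset.mem_Ico.1 hi).2
  rw [hf (k - 1) (by omega), mul_zero]
  rw [face_snd, if_pos (by omega), if_neg (by omega), if_neg (by omega)]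
  rwa [Nat.sub_add_cancel (by omega)]

/-- Only the two faces that merge the entry in `B` with a neighbour survive; the others keep it at
`j - 1` or `j`, both below `k`. -/
theorem ev_delta_of_vanishesBelow {n k j : ℕ} (hk : k ≤ n) (hj : j < k)
    {f : Cochain A (StrongDual ℂ Y) n} (hf : VanishesBelow B k f) {w : Word A Y}
    (hw : w.2 j ∈ B) :
    Cochain.ev (m.dual.delta n f) w =
      (-1) ^ j * (Cochain.ev f (face m n j w) - Cochain.ev f (face m n (j + 1) w)) := by
  rw [ev_delta_eq_sum_Ico m (by omega) (fun i hi => hf i (by omega)) hw,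
    Finset.sum_eq_sum_Ico_succ_bot (by omega), Finset.sum_eq_sum_Ico_succ_bot (by omega),
    Finset.sum_eq_zero (fun i hi => ?_)]
  · ring
  · have hi' := (Finset.mem_Ico.1 hi).1
    rw [hf j hj, mul_zero]
    rw [face_snd]
    split_ifs <;> first | exact hw | omega

theorem ev_face_sub_ev_face {n k : ℕ} (hk : k ≤ n) {f : Cochain A (StrongDual ℂ Y) (n + 1)}
    (hf : VanishesBelow B k f) {w : Word A Y} (hw : w.2 k ∈ B)
    (h : Cochain.ev (m.dual.delta (n + 1) f) w = 0) :
    Cochain.ev f (face m (n + 1) (k + 1) w) - Cochain.ev f (face m (n + 1) k w) =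
      ∑ i ∈ Finset.Ico (k + 1) (n + 2),
        (-1) ^ (k + i + 1) * Cochain.ev f (face m (n + 1) (i + 1) w) := by
  rw [ev_delta_eq_sum_Ico m (by omega) hf hw,
    Finset.sum_eq_sum_Ico_succ_bot (by omega), Finset.sum_eq_sum_Ico_succ_bot (by omega),
    ← Finset.sum_Ico_add' _ (k + 1) (n + 2) 1] at h
  have h2 : ∑ i ∈ Finset.Ico (k + 1) (n + 2),
        (-1) ^ (k + i + 1) * Cochain.ev f (face m (n + 1) (i + 1) w) =
      (-1) ^ k * ∑ i ∈ Finset.Ico (k + 1) (n + 2),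
        (-1) ^ (i + 1) * Cochain.ev f (face m (n + 1) (i + 1) w) := by
    rw [Finset.mul_sum]
    exact Finset.sum_congr rfl fun i _ => by ring
  rw [h2]
  have h3 : ((-1 : ℂ) ^ k) * (-1) ^ k = 1 := by rw [← mul_pow]; simp
  rw [pow_succ] at h
  linear_combination (-(-1 : ℂ) ^ k) * h + (Cochain.ev f (face m (n + 1) k w) -
    Cochain.ev f (face m (n + 1) (k + 1) w)) * h3

theorem average_vanishesBelow (N : StrongDual ℂ (UnitizedForm B)) {n : ℕ} (k : Fin (n + 1))
    {f : Cochain A (StrongDual ℂ Y) (n + 1)} (hf : VanishesBelow B k f) :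
    VanishesBelow B k (average m N k f) := by
  intro j hj w hw
  have h : insertForm m B k f (evFunctional n w) = 0 := by
    refine UnitizedForm.ext (fun c d => ?_) (fun d => ?_)
    · rw [onProd_insertForm, hf j hj]
      · simp
      · rw [ins_snd, if_pos hj, rmul_snd]
        split_ifs
        · exact B.mul_mem hw c.2
        · exact hw
    · rw [onOne_insertForm, hf j hj]
      · simp
      · rwa [ins_snd, if_pos hj]
  rw [ev_average, h, map_zero]

/-- The two surviving faces of the average are averages of equal forms, because the hypothesis on δf
equates the corresponding two faces of f for every inserted pair. -/
theorem ev_delta_average_eq_zero (N : StrongDual ℂ (UnitizedForm B)) {n : ℕ} (k : Fin (n + 1))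
    {f : Cochain A (StrongDual ℂ Y) (n + 1)} (hf : VanishesBelow B k f)
    (hδ : VanishesBelow B (n + 2) (m.dual.delta (n + 1) f)) {j : ℕ} (hj : j < k) {w : Word A Y}
    (hw : w.2 j ∈ B) : Cochain.ev (m.dual.delta n (average m N k f)) w = 0 := by
  have hk := k.is_le
  have key : ∀ W : Word A Y, W.2 j ∈ B →
      Cochain.ev f (face m (n + 1) j W) = Cochain.ev f (face m (n + 1) (j + 1) W) := fun W hW => by
    have h := hδ j (by omega) W hW
    rw [ev_delta_of_vanishesBelow m (by omega) hj hf hW] at h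
    simpa [sub_eq_zero] using h
  rw [ev_delta_of_vanishesBelow m hk hj (average_vanishesBelow m N k hf) hw, ev_average, ev_average]
  have h : insertForm m B k f (evFunctional n (face m n j w)) =
      insertForm m B k f (evFunctional n (face m n (j + 1) w)) := by
    refine UnitizedForm.ext (fun c d => ?_) (fun d => ?_)
    · rw [onProd_insertForm, onProd_insertForm, ins_rmul_face_of_le m _ _ _ hj.le hk,
        ins_rmul_face_of_le m _ _ _ hj hk]
      refine key _ ?_
      rw [ins_snd, if_pos (by omega), rmul_snd, if_neg (by omega)]
      exact hw
    · rw [onOne_insertForm, onOne_insertForm, ins_face_of_le m _ _ _ hj.le hk,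
        ins_face_of_le m _ _ _ hj hk]
      refine key _ ?_
      rw [ins_snd, if_pos (by omega)]
      exact hw
  rw [h, sub_self, mul_zero]

/-- With b the entry at `k` and Φ the form of the word without it, f(w) = Φ(1, b) = N(Φ · b) - N(b ·
Φ). Here Φ · b is the form of face `k`, and the vanishing of δf expresses b · Φ through the later
faces. -/
theorem ev_eq_ev_delta_average {N : StrongDual ℂ (UnitizedForm B)}
    (hN : ∀ b Φ, N (UnitizedForm.rightAct b Φ) - N (UnitizedForm.leftAct b Φ) =
      UnitizedForm.onOne Φ b) {n : ℕ} (k : Fin (n + 1))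
    {f : Cochain A (StrongDual ℂ Y) (n + 1)} (hf : VanishesBelow B k f)
    (hδ : VanishesBelow B (n + 2) (m.dual.delta (n + 1) f)) {w : Word A Y}
    (hw : w.2 k ∈ B) :
    Cochain.ev f w = (-1) ^ (k : ℕ) * Cochain.ev (m.dual.delta n (average m N k f)) w := by
  have hk := k.is_le
  let b : B := ⟨w.2 k, hw⟩
  let Φ := insertForm m B k f (evFunctional n (del k w))
  have hface : face m n k w = rmul m k (b : A) (del k w) := by
    rw [face_of_le m hk, rmul_del]; rfl
  have hins : ∀ x, ins k (b : A) (rmul m k x (del k w)) = rmul m k x w := fun x => by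
    rw [← rmul_ins]
    exact congrArg _ (ins_del _ w)
  have h₁ : UnitizedForm.rightAct b Φ = insertForm m B k f (evFunctional n (face m n k w)) := by
    refine UnitizedForm.ext (fun c d => ?_) (fun d => ?_)
    · rw [UnitizedForm.rightAct_onProd, onProd_insertForm, onProd_insertForm, hface, rmul_rmul]
      rfl
    · rw [UnitizedForm.rightAct_onOne, onProd_insertForm, onOne_insertForm, hface]
  have h₂ : UnitizedForm.leftAct b Φ = ∑ i ∈ Finset.Ico ((k : ℕ) + 1) (n + 2),
      (-1 : ℂ) ^ ((k : ℕ) + i + 1) • insertForm m B k f (evFunctional n (face m n i w)) := by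
    refine UnitizedForm.ext (fun c d => ?_) (fun d => ?_)
    -- Here Φ(c, db) and Φ(cd, b) are the faces `k + 1` and `k` of w with the pair c, d inserted, so
    -- their difference is read off from δf = 0 at that word.
    · have hW : (ins k (d : A) (rmul m k (c : A) w)).2 k ∈ B := by
        simp [ins_snd]
      have h := ev_face_sub_ev_face m hk hf hW (hδ k (by omega) _ hW)
      rw [face_ins_rmul m _ _ (by omega), face_succ_ins_rmul m _ _ (by omega)] at h
      rw [UnitizedForm.leftAct_onProd, onProd_insertForm, onProd_insertForm]
      simp only [map_sum, map_smul, sum_apply, smul_apply, onProd_insertForm, smul_eq_mul]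
      refine Eq.trans ?_ (h.trans (Finset.sum_congr rfl fun i hi => ?_))
      · rw [← hins]
        rfl
      · rw [face_ins_rmul_of_gt m _ _ _ (Finset.mem_Ico.1 hi).1 hk]
    · have hW : (ins k (d : A) w).2 k ∈ B := by simp [ins_snd]
      have h := ev_face_sub_ev_face m hk hf hW (hδ k (by omega) _ hW)
      rw [face_ins m _ _ (by omega), face_succ_ins m _ _ (by omega)] at h
      rw [UnitizedForm.leftAct_onOne, onProd_insertForm, onOne_insertForm]
      simp only [map_sum, map_smul, sum_apply, smul_apply, onOne_insertForm, smul_eq_mul]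
      refine Eq.trans ?_ (h.trans (Finset.sum_congr rfl fun i hi => ?_))
      · rw [← hins]
        rfl
      · rw [face_ins_of_gt m _ _ _ (Finset.mem_Ico.1 hi).1 hk]
  have h₃ := hN b Φ
  rw [h₁, h₂, onOne_insertForm, map_sum, ← ev_average] at h₃
  simp only [map_smul, ← ev_average, smul_eq_mul] at h₃
  rw [show ins k (b : A) (del k w) = w from ins_del k w] at h₃
  rw [← h₃, ev_delta_eq_sum_Ico m hk (average_vanishesBelow m N k hf) hw,
    Finset.sum_eq_sum_Ico_succ_bot (by omega : (k : ℕ) < n + 2), mul_add,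
    ← mul_assoc, ← mul_pow, Finset.mul_sum, sub_eq_add_neg, ← Finset.sum_neg_distrib]
  congr 1
  · simp
  · exact Finset.sum_congr rfl fun i _ => by ring

end Step

/-! ### Relative cochains and bijectivity -/

section Relative

variable {A : Type u} [NonUnitalNormedRing A] [NormedSpace ℂ A] [IsScalarTower ℂ A A]
  [SMulCommClass ℂ A A] {Y : Type v} [NormedAddCommGroup Y] [NormedSpace ℂ Y]
  (m : BanachBimodule A Y) (B : NonUnitalSubalgebra ℂ A)

namespace Word

theorem ins_rmul_rmul_of_lt (k i : ℕ) (hi : i < k) (b c d : A) (w : Word A Y) :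
    ins k d (rmul m k c (rmul m i b w)) = rmul m i b (ins k d (rmul m k c w)) := by
  refine Prod.ext ?_ (funext fun l => ?_)
  · simp only [rmul_fst, ins_fst]
    grind
  · simp only [rmul_snd, ins_snd]
    grind

theorem ins_rmul_rmul_of_gt (k i : ℕ) (hi : k < i) (b c d : A) (w : Word A Y) :
    ins k d (rmul m k c (rmul m i b w)) = rmul m (i + 1) b (ins k d (rmul m k c w)) := by
  refine Prod.ext ?_ (funext fun l => ?_)
  · simp only [rmul_fst, ins_fst]
    grind
  · simp only [rmul_snd, ins_snd]
    grind

theorem ins_rmul_lmul_of_lt (n k i : ℕ) (hi : i < k) (hk : k ≤ n) (b c d : A) (w : Word A Y) :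
    ins k d (rmul m k c (lmul m n i b w)) = lmul m (n + 1) i b (ins k d (rmul m k c w)) := by
  refine Prod.ext ?_ (funext fun l => ?_)
  · simp only [rmul_fst, lmul_fst, ins_fst]
    grind
  · simp only [rmul_snd, lmul_snd, ins_snd]
    grind

theorem ins_rmul_lmul_of_gt (n k i : ℕ) (hi : k < i) (b c d : A) (w : Word A Y) :
    ins k d (rmul m k c (lmul m n i b w)) = lmul m (n + 1) (i + 1) b (ins k d (rmul m k c w)) := by
  refine Prod.ext ?_ (funext fun l => ?_)
  · simp only [rmul_fst, lmul_fst, ins_fst]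
    grind [m.left_right]
  · simp only [rmul_snd, lmul_snd, ins_snd]
    grind

theorem ins_rmul_of_lt (k i : ℕ) (hi : i < k) (b d : A) (w : Word A Y) :
    ins k d (rmul m i b w) = rmul m i b (ins k d w) := by
  refine Prod.ext ?_ (funext fun l => ?_)
  · simp only [rmul_fst, ins_fst]
  · simp only [rmul_snd, ins_snd]
    grind

theorem ins_rmul_of_gt (k i : ℕ) (hi : k < i) (b d : A) (w : Word A Y) :
    ins k d (rmul m i b w) = rmul m (i + 1) b (ins k d w) := by
  refine Prod.ext ?_ (funext fun l => ?_)
  · simp only [rmul_fst, ins_fst]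
    grind
  · simp only [rmul_snd, ins_snd]
    grind

theorem ins_lmul_of_lt (n k i : ℕ) (hi : i < k) (hk : k ≤ n) (b d : A) (w : Word A Y) :
    ins k d (lmul m n i b w) = lmul m (n + 1) i b (ins k d w) := by
  refine Prod.ext ?_ (funext fun l => ?_)
  · simp only [lmul_fst, ins_fst]
    grind
  · simp only [lmul_snd, ins_snd]
    grind

theorem ins_lmul_of_ge (n k i : ℕ) (hi : k ≤ i) (b d : A) (w : Word A Y) :
    ins k d (lmul m n i b w) = lmul m (n + 1) (i + 1) b (ins k d w) := by
  refine Prod.ext ?_ (funext fun l => ?_)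
  · simp only [lmul_fst, ins_fst]
    grind
  · simp only [lmul_snd, ins_snd]
    grind

theorem lmul_ins (n k : ℕ) (hk : k < n) (c d : A) (w : Word A Y) :
    lmul m n k c (ins k d w) = ins k (c * d) w := by
  refine Prod.ext ?_ (funext fun l => ?_)
  · simp only [lmul_fst, ins_fst]
    grind
  · simp only [lmul_snd, ins_snd]
    grind

theorem rmul_succ_ins (k : ℕ) (c d : A) (w : Word A Y) :
    rmul m (k + 1) c (ins k d w) = ins k (d * c) w := by
  refine Prod.ext ?_ (funext fun l => ?_)
  · simp only [rmul_fst, ins_fst]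
    grind
  · simp only [rmul_snd, ins_snd]
    grind

end Word

/-- The relations of a `B`-relative cochain on words. -/
def IsRelative {n : ℕ} (f : Cochain A (StrongDual ℂ Y) n) : Prop :=
  ∀ b ∈ B, ∀ i ≤ n, ∀ w : Word A Y, Cochain.ev f (rmul m i b w) = Cochain.ev f (lmul m n i b w)

/-- On cyclic words the left, middle and right relations, and centrality in degree 0, all say that b
may cross any of the `n + 1` gaps. -/
theorem mem_relCochains_iff {n : ℕ} {f : Cochain A (StrongDual ℂ Y) n} :
    f ∈ m.dual.relCochains B n ↔ IsRelative m B f := by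
  cases n with
  | zero =>
    have e : ∀ g : Fin 0 → A, f g = f ![] := fun g => congrArg f (Subsingleton.elim _ _)
    constructor
    · intro hf b hb i hi w
      obtain rfl : i = 0 := by omega
      have h := congrArg (fun φ => φ w.1) (hf b hb)
      simpa [Cochain.ev, rmul, lmul, e, BanachBimodule.dual_left_apply,
        BanachBimodule.dual_right_apply] using h
    · intro hf b hb
      ext y
      have h := hf b hb 0 le_rfl (y, 0)
      simpa [Cochain.ev, rmul, lmul, e, BanachBimodule.dual_left_apply,
        BanachBimodule.dual_right_apply] using h
  | succ n =>
    have hr : ∀ (i : Fin (n + 1)) (b : A) (w : Word A Y),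
        Cochain.ev f (rmul m (i + 1) b w) =
          f (Function.update (fun j : Fin (n + 1) => w.2 j) i (w.2 i * b)) w.1 := fun i b w => by
      unfold Cochain.ev
      congr 2
      ext j
      simp only [rmul_snd, Function.update_apply, Fin.ext_iff]
      grind
    have hl : ∀ (i : Fin (n + 1)) (b : A) (w : Word A Y),
        Cochain.ev f (lmul m (n + 1) i b w) =
          f (Function.update (fun j : Fin (n + 1) => w.2 j) i (b * w.2 i)) w.1 := fun i b w => by
      rw [Cochain.ev, lmul, if_pos i.2]
      congr 2
      ext j
      simp only [Function.update_apply, Fin.ext_iff]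
      grind
    constructor
    · intro hf b hb i hi w
      obtain ⟨h₁, h₂, h₃⟩ := hf b hb (fun j => w.2 j)
      rcases Nat.eq_zero_or_pos i with rfl | hi0
      · have h := congrArg (fun φ => φ w.1) h₁
        exact h.symm.trans (hl 0 b w).symm
      obtain ⟨i, rfl⟩ : ∃ i', i = i' + 1 := ⟨i - 1, by omega⟩
      rcases hi.eq_or_lt with hi' | hi'
      · obtain rfl : i = n := by omega
        have h := congrArg (fun φ => φ w.1) h₃
        refine (hr (Fin.last i) b w).trans (h.trans ?_)
        rw [lmul, if_neg (by omega)]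
        rfl
      · have h := congrArg (fun φ => φ w.1) (h₂ ⟨i, by omega⟩)
        exact (hr ⟨i, by omega⟩ b w).trans (h.trans (hl ⟨i + 1, by omega⟩ b w).symm)
    · intro hf b hb a
      obtain ⟨α, rfl⟩ : ∃ α : ℕ → A, a = fun j : Fin (n + 1) => α j :=
        ⟨fun l => if h : l < n + 1 then a ⟨l, h⟩ else 0, by
          funext j; simp only [j.2, dite_true]⟩
      refine ⟨?_, fun i => ?_, ?_⟩ <;> ext y
      · exact ((hf b hb 0 (by omega) (y, α)).trans (hl 0 b (y, α))).symm
      · exact (hr i.castSucc b (y, α)).symm.trans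
          ((hf b hb (i + 1) (by omega) (y, α)).trans (hl i.succ b (y, α)))
      · refine (hr (Fin.last n) b (y, α)).symm.trans
          ((hf b hb (n + 1) (by omega) (y, α)).trans ?_)
        rw [lmul, if_neg (by omega)]
        rfl

variable {B}

theorem IsRelative.delta {n : ℕ} {f : Cochain A (StrongDual ℂ Y) n} (hf : IsRelative m B f) :
    IsRelative m B (m.dual.delta n f) := by
  intro b hb j hj w
  rw [Cochain.ev_delta, Cochain.ev_delta]
  refine Finset.sum_congr rfl fun i hi => ?_
  have hi' := Finset.mem_range.1 hi
  congr 1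
  -- If the face merges across another gap, the relation for f applies at the shifted gap; if it
  -- merges across the gap of b, both words agree by associativity.
  rcases lt_trichotomy i j with h | rfl | h
  · obtain ⟨j, rfl⟩ : ∃ j', j = j' + 1 := ⟨j - 1, by omega⟩
    refine Eq.trans ?_ ((hf b hb j (by omega) (face m n i w)).trans ?_) <;>
      refine Cochain.ev_congr f ?_ fun l hl => ?_
    · simp only [face_fst, rmul_fst, rmul_snd]
      grind [m.right_mul]
    · simp only [face_snd, rmul_snd]
      grind
    · simp only [face_fst, lmul_fst, lmul_snd]
      grind [m.left_right]
    · simp only [face_snd, lmul_snd]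
      grind
  · refine Cochain.ev_congr f ?_ fun l hl => ?_
    · simp only [face_fst, lmul_fst, lmul_snd, rmul_fst, rmul_snd]
      grind [m.right_mul, m.left_mul]
    · simp only [face_snd, lmul_snd, rmul_snd]
      grind [mul_assoc]
  · refine Eq.trans ?_ ((hf b hb j (by omega) (face m n i w)).trans ?_) <;>
      refine Cochain.ev_congr f ?_ fun l hl => ?_
    · simp only [face_fst, rmul_fst, rmul_snd]
      grind [m.left_right]
    · simp only [face_snd, rmul_snd]
      grind
    · simp only [face_fst, lmul_fst, lmul_snd]
      grind [m.left_mul]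
    · simp only [face_snd, lmul_snd]
      grind

/-- Away from the gap `k`, b crosses as it does for f. At the gap itself the form is θ(cd) with θ(d)
= f(…, d, …); multiplying by b on either side turns θ into θ(b ·) or θ(· b), and the normalization
of N averages both to θ(b). -/
theorem IsRelative.average {N : StrongDual ℂ (UnitizedForm B)}
    (hl : ∀ (θ : B →L[ℂ] ℂ) b,
      N (UnitizedForm.ofMul (θ.comp (ContinuousLinearMap.mul ℂ B b))) = θ b)
    (hr : ∀ (θ : B →L[ℂ] ℂ) b,
      N (UnitizedForm.ofMul (θ.comp ((ContinuousLinearMap.mul ℂ B).flip b))) = θ b)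
    {n : ℕ} (k : Fin (n + 1)) {f : Cochain A (StrongDual ℂ Y) (n + 1)} (hf : IsRelative m B f) :
    IsRelative m B (average m N k f) := by
  have hk := k.is_le
  intro b hb i hi w
  rw [ev_average, ev_average]
  rcases lt_trichotomy i k with h | h | h
  · congr 1
    refine UnitizedForm.ext (fun c d => ?_) (fun d => ?_)
    · rw [onProd_insertForm, onProd_insertForm, ins_rmul_rmul_of_lt m _ _ h,
        ins_rmul_lmul_of_lt m _ _ _ h hk, hf b hb i (by omega)]
    · rw [onOne_insertForm, onOne_insertForm, ins_rmul_of_lt m _ _ h,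
        ins_lmul_of_lt m _ _ _ h hk, hf b hb i (by omega)]
  · subst h
    have key : ∀ w, insertForm m B k f (evFunctional n w) =
        UnitizedForm.ofMul (UnitizedForm.onOne (insertForm m B k f (evFunctional n w))) := by
      intro w
      refine UnitizedForm.ext (fun c d => ?_) (fun d => rfl)
      rw [UnitizedForm.onProd_ofMul, onProd_insertForm, onOne_insertForm, ← rmul_ins,
        hf c c.2 k (by omega), lmul_ins m _ _ (by omega)]
      rfl
    let b' : B := ⟨b, hb⟩
    have h₁ : UnitizedForm.onOne (insertForm m B k f (evFunctional n (rmul m k b w))) =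
        (UnitizedForm.onOne (insertForm m B k f (evFunctional n w))).comp
          (ContinuousLinearMap.mul ℂ B b') := by
      ext d
      rw [ContinuousLinearMap.comp_apply, onOne_insertForm, onOne_insertForm, ← rmul_ins,
        hf b hb k (by omega), lmul_ins m _ _ (by omega)]
      rfl
    have h₂ : UnitizedForm.onOne (insertForm m B k f (evFunctional n (lmul m n k b w))) =
        (UnitizedForm.onOne (insertForm m B k f (evFunctional n w))).comp
          ((ContinuousLinearMap.mul ℂ B).flip b') := by
      ext d
      rw [ContinuousLinearMap.comp_apply, onOne_insertForm, onOne_insertForm,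
        ins_lmul_of_ge m _ _ _ le_rfl, ← hf b hb (k + 1) (by omega), rmul_succ_ins]
      rfl
    rw [key (rmul m k b w), key (lmul m n k b w), h₁, h₂, hl, hr]
  · congr 1
    refine UnitizedForm.ext (fun c d => ?_) (fun d => ?_)
    · rw [onProd_insertForm, onProd_insertForm, ins_rmul_rmul_of_gt m _ _ h,
        ins_rmul_lmul_of_gt m _ _ _ h, hf b hb (i + 1) (by omega)]
    · rw [onOne_insertForm, onOne_insertForm, ins_rmul_of_gt m _ _ h,
        ins_lmul_of_ge m _ _ _ h.le, hf b hb (i + 1) (by omega)]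

/-- In δf evaluated with b inserted at `i`, only the two faces merging b to its left and to its
right survive. -/
theorem isRelative_of_vanishesBelow {n : ℕ} {f : Cochain A (StrongDual ℂ Y) n}
    (hf : VanishesBelow B n f) (hδ : VanishesBelow B (n + 1) (m.dual.delta n f)) :
    IsRelative m B f := by
  intro b hb i hi w
  have hW : (ins i b w).2 i ∈ B := by simpa [ins_snd] using hb
  have h := hδ i (by omega) _ hW
  have h' : Cochain.ev f (face m n i (ins i b w)) =
      Cochain.ev f (face m n (i + 1) (ins i b w)) := by
    -- For i = n the vanishing of f says nothing about position n, but there only the last two faces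
    -- remain anyway.
    rcases hi.eq_or_lt with rfl | hi'
    · rw [ev_delta_eq_sum_Ico m le_rfl hf hW, Finset.sum_eq_sum_Ico_succ_bot (by omega),
        Finset.sum_eq_sum_Ico_succ_bot (by omega), Finset.Ico_self, Finset.sum_empty, pow_succ] at h
      have h0 : (-1 : ℂ) ^ i * (Cochain.ev f (face m i i (ins i b w)) -
        Cochain.ev f (face m i (i + 1) (ins i b w))) = 0 := by linear_combination h
      simpa [sub_eq_zero] using h0
    · rw [ev_delta_of_vanishesBelow m le_rfl hi' hf hW] at h
      simpa [sub_eq_zero] using h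
  rw [face_ins m _ _ hi] at h'
  rw [h']
  refine Cochain.ev_congr f ?_ fun l hl => ?_
  · simp only [face_fst, lmul_fst, ins_fst, ins_snd]
    grind
  · simp only [face_snd, lmul_snd, ins_snd]
    grind

theorem exists_vanishesBelow (hB : IsAmenable.{u, max u v} B) {n : ℕ}
    {f : Cochain A (StrongDual ℂ Y) (n + 1)}
    (hδ : VanishesBelow B (n + 2) (m.dual.delta (n + 1) f)) :
    ∃ g : Cochain A (StrongDual ℂ Y) n, VanishesBelow B (n + 1) (f - m.dual.delta n g) ∧
      (IsRelative m B f → IsRelative m B g) := by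
  obtain ⟨N, hN, hl, hr⟩ := hB.exists_normalized_functional
  suffices h : ∀ k ≤ n + 1, ∃ g : Cochain A (StrongDual ℂ Y) n,
      VanishesBelow B k (f - m.dual.delta n g) ∧ (IsRelative m B f → IsRelative m B g) from
    h (n + 1) le_rfl
  intro k
  induction k with
  | zero =>
    exact fun _ => ⟨0, fun j hj => absurd hj (Nat.not_lt_zero j), fun _ b _ i _ w => rfl⟩
  | succ k ih =>
    intro hk
    obtain ⟨g, hg, hrel⟩ := ih (by omega)
    let k' : Fin (n + 1) := ⟨k, by omega⟩
    have hδ' : VanishesBelow B (n + 2) (m.dual.delta (n + 1) (f - m.dual.delta n g)) := by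
      rwa [map_sub, m.dual_delta_delta, sub_zero]
    let ζ := BanachCohomology.average m N k' (f - m.dual.delta n g)
    -- The sign inverts the factor (-1)^k between f - δg and δζ on slot `k`; slots below `k` are not
    -- disturbed.
    refine ⟨g + (-1 : ℂ) ^ k • ζ, fun j hj w hw => ?_, fun hf b hb i hi w => ?_⟩
    · rw [map_add, map_smul, ← sub_sub, Cochain.ev_sub, Cochain.ev_smul, sub_eq_zero]
      rcases (Nat.lt_succ_iff.1 hj).eq_or_lt with rfl | hj'
      · exact ev_eq_ev_delta_average m hN k' hg hδ' hw
      · rw [hg j hj' w hw, ev_delta_average_eq_zero m N k' hg hδ' hj' hw, mul_zero]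
    · have h₁ := hrel hf
      have h₂ : IsRelative m B (f - m.dual.delta n g) := fun b hb i hi w => by
        rw [Cochain.ev_sub, Cochain.ev_sub, hf b hb i hi, h₁.delta m b hb i hi]
      have h₃ : IsRelative m B ζ := h₂.average m hl hr k'
      rw [Cochain.ev_add, Cochain.ev_add, Cochain.ev_smul, Cochain.ev_smul, h₁ b hb i hi,
        h₃ b hb i hi]

/-- A cochain whose coboundary vanishes if an argument lies in the amenable subalgebra `B` differs
from a `B`-relative one by a coboundary. -/
theorem exists_sub_mem_relCochains (hB : IsAmenable.{u, max u v} B) {n : ℕ}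
    {f : Cochain A (StrongDual ℂ Y) n} (hδ : VanishesBelow B (n + 1) (m.dual.delta n f)) :
    ∃ g ∈ m.dual.coboundaries n, f - g ∈ m.dual.relCochains B n := by
  cases n with
  | zero =>
    refine ⟨0, Submodule.zero_mem _, ?_⟩
    rw [sub_zero, mem_relCochains_iff]
    exact isRelative_of_vanishesBelow m (fun j hj => absurd hj (Nat.not_lt_zero j)) hδ
  | succ n =>
    obtain ⟨g, hg, -⟩ := exists_vanishesBelow m hB hδ
    refine ⟨m.dual.delta n g, ⟨g, rfl⟩, ?_⟩
    rw [mem_relCochains_iff]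
    refine isRelative_of_vanishesBelow m hg ?_
    rwa [map_sub, m.dual_delta_delta, sub_zero]

theorem BanachBimodule.dual_coboundaries_le_cocycles (n : ℕ) :
    m.dual.coboundaries n ≤ m.dual.cocycles n := by
  cases n with
  | zero => exact bot_le
  | succ n =>
    rintro _ ⟨g, rfl⟩
    exact m.dual_delta_delta g

theorem exists_relCocycle_sub_mem (hB : IsAmenable.{u, max u v} B) {n : ℕ}
    {f : Cochain A (StrongDual ℂ Y) n} (hf : f ∈ m.dual.cocycles n) :
    ∃ g ∈ m.dual.coboundaries n, f - g ∈ m.dual.relCocycles B n := by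
  have h0 : m.dual.delta n f = 0 := hf
  obtain ⟨g, hg, hfg⟩ := exists_sub_mem_relCochains m hB (f := f) (n := n)
    (fun j hj w hw => by rw [h0, Cochain.ev_zero])
  exact ⟨g, hg, hfg, Submodule.sub_mem _ hf (m.dual_coboundaries_le_cocycles n hg)⟩

/-- A primitive ξ of a relative cocycle is corrected by a cocycle. Reducing δξ yields a relative η
with δ(ξ - η) vanishing on `B`, hence ξ - η - g is relative for a coboundary g, and ξ - g is a
relative primitive. -/
theorem mem_relCoboundaries_of_mem_coboundaries (hB : IsAmenable.{u, max u v} B) {n : ℕ}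
    {f : Cochain A (StrongDual ℂ Y) n} (hf : f ∈ m.dual.relCocycles B n)
    (hf' : f ∈ m.dual.coboundaries n) : f ∈ m.dual.relCoboundaries B n := by
  cases n with
  | zero => exact hf'
  | succ n =>
    obtain ⟨ξ, rfl⟩ := hf'
    have h0 : m.dual.delta (n + 1) (m.dual.delta n ξ) = 0 := m.dual_delta_delta ξ
    obtain ⟨η, hη, hrel⟩ := exists_vanishesBelow m hB (f := m.dual.delta n ξ)
      (fun j hj w hw => by rw [h0, Cochain.ev_zero])
    rw [← map_sub] at hη
    obtain ⟨g, hg, hξ⟩ := exists_sub_mem_relCochains m hB hη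
    have hη' : η ∈ m.dual.relCochains B n :=
      (mem_relCochains_iff m B).2 (hrel ((mem_relCochains_iff m B).1 hf.1))
    refine ⟨ξ - g, ?_, ?_⟩
    · have := Submodule.add_mem _ hξ hη'
      rwa [show ξ - η - g + η = ξ - g by abel] at this
    · have hg' : m.dual.delta n g = 0 := m.dual_coboundaries_le_cocycles n hg
      rw [map_sub, hg', sub_zero]

end Relative

/-! ### Continuity of the inverse -/

section Topology

/-- Each value of δf depends continuously on f, so the closed graph theorem applies and no norm
estimate is needed. -/
theorem BanachBimodule.continuous_delta {A : Type*} [NonUnitalNormedRing A] [NormedSpace ℂ A]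
    [IsScalarTower ℂ A A] [SMulCommClass ℂ A A] {X : Type*} [NormedAddCommGroup X]
    [NormedSpace ℂ X] [CompleteSpace X] (m : BanachBimodule A X) (n : ℕ) :
    Continuous (m.delta n) := by
  have hev : ∀ (k : ℕ) (a : Fin k → A), Continuous fun f : Cochain A X k => f a := fun k a =>
    (ContinuousMultilinearMap.apply ℂ (fun _ : Fin k => A) X a).continuous
  refine LinearMap.continuous_of_seq_closed_graph _ fun u x y hu hy => ?_
  ext a
  refine tendsto_nhds_unique (((hev _ a).tendsto y).comp hy) ?_
  have hc : Continuous fun f : Cochain A X n => m.delta n f a := by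
    simp only [BanachBimodule.delta_apply]
    refine (((m.left (a 0)).continuous.comp (hev n _)).add
      (continuous_finsetSum _ fun j _ => (hev n _).const_smul _)).add
      (((m.right _).continuous.comp (hev n _)).const_smul _)
  exact (hc.tendsto x).comp hu

/-- `N` need not be closed, so the Banach space `W` parametrizing it is used instead: (p, w) ↦ p + T
w maps P × W onto Z, hence is open, and modulo `N` it factors through the induced map. -/
theorem isOpenMap_mapQ_inclusion {E W : Type*} [NormedAddCommGroup E] [NormedSpace ℂ E]
    [CompleteSpace E] [NormedAddCommGroup W] [NormedSpace ℂ W] [CompleteSpace W]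
    {P Z R N : Submodule ℂ E} (hPZ : P ≤ Z) (hRN : R ≤ N) (hP : IsClosed (P : Set E))
    (hZ : IsClosed (Z : Set E)) (T : W →L[ℂ] E) (hTN : ∀ g, g ∈ N ↔ ∃ w, T w = g) (hNZ : N ≤ Z)
    (hsurj : ∀ z ∈ Z, ∃ g ∈ N, z - g ∈ P) :
    IsOpenMap (Submodule.mapQ (R.submoduleOf P) (N.submoduleOf Z) (Submodule.inclusion hPZ)
      (fun _ hx => hRN hx)) := by
  have : CompleteSpace P := hP.completeSpace_coe
  have : CompleteSpace Z := hZ.completeSpace_coe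
  have hTZ : ∀ w, T w ∈ Z := fun w => hNZ ((hTN _).2 ⟨w, rfl⟩)
  let Ψ : P × W →L[ℂ] Z :=
    (P.subtypeL.coprod T).codRestrict Z fun x => Z.add_mem (hPZ x.1.2) (hTZ x.2)
  have hΨ : Function.Surjective Ψ := fun z => by
    obtain ⟨g, hg, hzg⟩ := hsurj z z.2
    obtain ⟨w, rfl⟩ := (hTN _).1 hg
    exact ⟨(⟨_, hzg⟩, w), Subtype.ext (sub_add_cancel _ _)⟩
  have hcomp : (Submodule.mapQ (R.submoduleOf P) (N.submoduleOf Z) (Submodule.inclusion hPZ)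
      (fun _ hx => hRN hx)) ∘ (fun x : P × W => (R.submoduleOf P).mkQ x.1) =
      (N.submoduleOf Z).mkQ ∘ Ψ := by
    funext x
    refine (Submodule.Quotient.eq _).2 ?_
    have h : -T x.2 ∈ N := N.neg_mem ((hTN _).2 ⟨x.2, rfl⟩)
    change ((x.1 : E) - (x.1 + T x.2)) ∈ N
    rwa [sub_add_cancel_left]
  refine IsOpenMap.of_comp (f := fun x : P × W => (R.submoduleOf P).mkQ x.1) ?_ ?_ ?_
  · exact continuous_quot_mk.comp continuous_fst
  · exact (Submodule.mkQ_surjective _).comp Prod.fst_surjective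
  · rw [hcomp]
    exact (Submodule.isOpenMap_mkQ _).comp (Ψ.isOpenMap hΨ)

theorem BanachBimodule.isClosed_cocycles {A : Type*} [NonUnitalNormedRing A] [NormedSpace ℂ A]
    [IsScalarTower ℂ A A] [SMulCommClass ℂ A A] {X : Type*} [NormedAddCommGroup X]
    [NormedSpace ℂ X] [CompleteSpace X] (m : BanachBimodule A X) (n : ℕ) :
    IsClosed (m.cocycles n : Set (Cochain A X n)) :=
  isClosed_singleton.preimage (m.continuous_delta n)

theorem BanachBimodule.isClosed_relCochains {A : Type*} [NonUnitalNormedRing A] [NormedSpace ℂ A]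
    [IsScalarTower ℂ A A] [SMulCommClass ℂ A A] {X : Type*} [NormedAddCommGroup X]
    [NormedSpace ℂ X] (m : BanachBimodule A X) (S : NonUnitalSubalgebra ℂ A) (n : ℕ) :
    IsClosed (m.relCochains S n : Set (Cochain A X n)) := by
  have hev : ∀ (k : ℕ) (a : Fin k → A), Continuous fun f : Cochain A X k => f a := fun k a =>
    (ContinuousMultilinearMap.apply ℂ (fun _ : Fin k => A) X a).continuous
  cases n with
  | zero =>
    have : (m.relCochains S 0 : Set (Cochain A X 0)) =
        ⋂ s ∈ S, {f | m.left s (f ![]) = m.right s (f ![])} := by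
      ext f; simp [BanachBimodule.relCochains]
    rw [this]
    exact isClosed_biInter fun s _ => isClosed_eq ((m.left s).continuous.comp (hev 0 _))
      ((m.right s).continuous.comp (hev 0 _))
  | succ n =>
    simp only [BanachBimodule.relCochains, Submodule.coe_set_mk, AddSubmonoid.coe_set_mk,
      AddSubsemigroup.coe_set_mk, Set.ofPred_forall, Set.ofPred_and]
    refine isClosed_iInter fun s => isClosed_iInter fun _ => isClosed_iInter fun a => ?_
    exact (isClosed_eq (hev _ _) ((m.left s).continuous.comp (hev _ _))).inter
      ((isClosed_iInter fun i => isClosed_eq (hev _ _) (hev _ _)).inter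
        (isClosed_eq (hev _ _) ((m.right s).continuous.comp (hev _ _))))

theorem BanachBimodule.isClosed_relCocycles {A : Type*} [NonUnitalNormedRing A] [NormedSpace ℂ A]
    [IsScalarTower ℂ A A] [SMulCommClass ℂ A A] {X : Type*} [NormedAddCommGroup X]
    [NormedSpace ℂ X] [CompleteSpace X] (m : BanachBimodule A X) (S : NonUnitalSubalgebra ℂ A)
    (n : ℕ) : IsClosed (m.relCocycles S n : Set (Cochain A X n)) :=
  (m.isClosed_relCochains S n).inter (m.isClosed_cocycles n)

theorem BanachBimodule.continuous_relToCohomology {A : Type*} [NonUnitalNormedRing A]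
    [NormedSpace ℂ A] [IsScalarTower ℂ A A] [SMulCommClass ℂ A A] {X : Type*}
    [NormedAddCommGroup X] [NormedSpace ℂ X] (m : BanachBimodule A X)
    (S : NonUnitalSubalgebra ℂ A) (n : ℕ) : Continuous (m.relToCohomology S n) :=
  continuous_quot_lift _ (continuous_quot_mk.comp
    (continuous_subtype_val.subtype_mk fun x => m.relCocycles_le S n x.2))

section Amenable

variable {A : Type u} [NonUnitalNormedRing A] [NormedSpace ℂ A] [IsScalarTower ℂ A A]
  [SMulCommClass ℂ A A] {Y : Type v} [NormedAddCommGroup Y] [NormedSpace ℂ Y]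
  (m : BanachBimodule A Y) {B : NonUnitalSubalgebra ℂ A}

theorem bijective_relToCohomology (hB : IsAmenable.{u, max u v} B) (n : ℕ) :
    Function.Bijective (m.dual.relToCohomology B n) := by
  constructor
  · rw [injective_iff_map_eq_zero]
    intro x hx
    obtain ⟨f, rfl⟩ := Submodule.mkQ_surjective _ x
    have h := (Submodule.Quotient.mk_eq_zero _).1 hx
    exact (Submodule.Quotient.mk_eq_zero _).2 (mem_relCoboundaries_of_mem_coboundaries m hB f.2 h)
  · intro x
    obtain ⟨f, rfl⟩ := Submodule.mkQ_surjective _ x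
    obtain ⟨g, hg, hfg⟩ := exists_relCocycle_sub_mem m hB f.2
    refine ⟨Submodule.Quotient.mk ⟨_, hfg⟩, (Submodule.Quotient.eq _).2 ?_⟩
    change ((f : Cochain A (StrongDual ℂ Y) n) - g) - f ∈ m.dual.coboundaries n
    rw [sub_sub_cancel_left]
    exact Submodule.neg_mem _ hg

theorem isOpenMap_relToCohomology (hB : IsAmenable.{u, max u v} B) (n : ℕ) :
    IsOpenMap (m.dual.relToCohomology B n) := by
  obtain _ | n := n
  -- In degree 0 there are no nonzero coboundaries, so they are parametrized by the zero map.
  · exact isOpenMap_mapQ_inclusion (m.dual.relCocycles_le B 0) (m.dual.relCoboundaries_le B 0)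
      (m.dual.isClosed_relCocycles B 0) (m.dual.isClosed_cocycles 0)
      (0 : Cochain A (StrongDual ℂ Y) 0 →L[ℂ] Cochain A (StrongDual ℂ Y) 0)
      (fun g => ⟨fun h => ⟨0, ((Submodule.mem_bot ℂ).1 h).symm⟩,
        fun ⟨_, h⟩ => (Submodule.mem_bot ℂ).2 h.symm⟩)
      (m.dual_coboundaries_le_cocycles 0) (fun z hz => exists_relCocycle_sub_mem m hB hz)
  · exact isOpenMap_mapQ_inclusion (m.dual.relCocycles_le B (n + 1))
      (m.dual.relCoboundaries_le B (n + 1)) (m.dual.isClosed_relCocycles B (n + 1))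
      (m.dual.isClosed_cocycles (n + 1)) ⟨m.dual.delta n, m.dual.continuous_delta n⟩
      (fun g => Iff.rfl) (m.dual_coboundaries_le_cocycles (n + 1))
      (fun z hz => exists_relCocycle_sub_mem m hB hz)

end Amenable

end Topology

end BanachCohomology

end

theorem theorem1p6
    {A : Type u} [NonUnitalNormedRing A] [NormedSpace ℂ A] [IsScalarTower ℂ A A]
    [SMulCommClass ℂ A A] [CompleteSpace A]
    (B : NonUnitalSubalgebra ℂ A) (hBclosed : IsClosed (B : Set A))
    (hB : BanachCohomology.IsAmenable.{u, max u v} B)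
    {Y : Type v} [NormedAddCommGroup Y] [NormedSpace ℂ Y] [CompleteSpace Y]
    (m : BanachCohomology.BanachBimodule A Y) (n : ℕ) :
    ∃ e : m.dual.RelCohomology B n ≃L[ℂ] m.dual.Cohomology n,
      ∀ x, e x = m.dual.relToCohomology B n x := by
  let e := LinearEquiv.ofBijective (m.dual.relToCohomology B n)
    (BanachCohomology.bijective_relToCohomology m hB n)
  exact ⟨ContinuousLinearEquiv.mk e (m.dual.continuous_relToCohomology B n)
    ((e.toEquiv.continuous_symm_iff).2 (BanachCohomology.isOpenMap_relToCohomology m hB n)),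
    fun x => rfl⟩
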